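/- Let $n\ge 3$, let $\mathbb{B}^n$ be the open unit ball of $\mathbb{R}^n$ with Euclidean norm $|\cdot|$, and let $h:\mathbb{B}^n\to(-1,1)$ be hyperbolic harmonic, i.e. $h$ is of class $C^2$ and $\Delta_h h=0$ on $\mathbb{B}^n$, where $$\Delta_h u(x)=(1-|x|^2)^2\,\Delta u(x)+2(n-2)(1-|x|^2)\sum_{i=1}^n x_i\frac{\partial u}{\partial x_i}(x)$$ and $\Delta$ is the Laplacian on $\mathbb{R}^n$. Then $$|\nabla h(x)|\le (n-1)\,\frac{1-|h(x)|^2}{1-|x|^2},\qquad x\in\mathbb{B}^n .$$ Consequently, $$d_{h_2}\big(h(x_1),h(x_2)\big)\le (n-1)\,d_{h_n}(x_1,x_2),\qquad x_1,x_2\in\mathbb{B}^n,$$ where, for $m\ge 2$, $d_{h_m}$ denotes the hyperbolic distance of $\mathbb{B}^m$, that is, $d_{h_m}(x,y)$ is the infimum of $\int_0^1 \frac{2|\gamma'(t)|}{1-|\gamma(t)|^2}\,dt$ over all $C^1$ curves $\gamma:[0,1]\to\mathbb{B}^m$ from $x$ to $y$. For $m=2$ it is the Poincaré distance of the unit disc,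 and $(-1,1)$ is identified with the real diameter $\{(t,0):-1<t<1\}$ of that disc. -/

import Mathlib

open Set InnerProductSpace
open scoped Gradient

noncomputable section

/-- The open unit ball of Euclidean `ℝⁿ`. -/
def unitBall (n : ℕ) : Set (EuclideanSpace ℝ (Fin n)) := Metric.ball 0 1

/-- The hyperbolic Laplacian
`Δ_h u(x) = (1 - |x|²)² Δu(x) + 2(n - 2)(1 - |x|²) ∑ xᵢ ∂u/∂xᵢ(x)`. -/
def hyperbolicLaplacian {n : ℕ} (u : EuclideanSpace ℝ (Fin n) → ℝ)
    (x : EuclideanSpace ℝ (Fin n)) : ℝ :=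
  (1 - ‖x‖ ^ 2) ^ 2 * Laplacian.laplacian u x
    + 2 * ((n : ℝ) - 2) * (1 - ‖x‖ ^ 2)
      * ∑ i : Fin n, x i * fderiv ℝ u x (EuclideanSpace.single i 1)

/-- `u` is of class `C²` on the unit ball and `Δ_h u = 0` there. Only the values of `u` on the
open unit ball matter. -/
def IsHyperbolicHarmonic {n : ℕ} (u : EuclideanSpace ℝ (Fin n) → ℝ) : Prop :=
  ContDiffOn ℝ 2 u (unitBall n) ∧ ∀ x ∈ unitBall n, hyperbolicLaplacian u x = 0

/-- `γ`, restricted to `[0, 1]`, is a `C¹` curve in the unit ball from `x` to `y`. -/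
structure IsBallCurve {n : ℕ} (γ : ℝ → EuclideanSpace ℝ (Fin n))
    (x y : EuclideanSpace ℝ (Fin n)) : Prop where
  contDiffOn : ContDiffOn ℝ 1 γ (Icc 0 1)
  mapsTo : MapsTo γ (Icc 0 1) (unitBall n)
  source : γ 0 = x
  target : γ 1 = y

/-- The length over `[0, 1]` of a curve for the metric `2|dx| / (1 - |x|²)` of constant
curvature `-1`. -/
def hyperbolicLength {n : ℕ} (γ : ℝ → EuclideanSpace ℝ (Fin n)) : ℝ :=
  ∫ t in (0 : ℝ)..1, 2 * ‖derivWithin γ (Icc 0 1) t‖ / (1 - ‖γ t‖ ^ 2)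

/-- The hyperbolic distance of the unit ball: the infimum of the hyperbolic lengths of curves
joining two points. For `n = 2` this is the Poincaré distance of the unit disc. -/
def hyperbolicDist {n : ℕ} (x y : EuclideanSpace ℝ (Fin n)) : ℝ :=
  sInf {L : ℝ | ∃ γ : ℝ → EuclideanSpace ℝ (Fin n), IsBallCurve γ x y ∧ L = hyperbolicLength γ}

end

open MeasureTheory Metric Filter Topology

/-! Write `ρ = 1 - |x|²`. The core is the estimate at the origin, `∂ₑh(0) ≤ (n - 1)(1 - h(0)²)` for
a unit vector `e`. Inversions preserving the ball carry it to every point, and integration along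
curves gives the distance estimate.

No Poisson kernel or boundary values are used. They are replaced by integrals against radial weights
supported inside the ball. Take a radial profile `m` and put `w(s) = 2n m(s) - 2(1 - s) m'(s)`, with
`C = ∫ m(|x|²)` and `W = ∫ w(|x|²)`. Then `∫ h w = h(0) W` (`integral_mul_radial`) and `∫ h ⟪e, x⟫ w
= ∂ₑh(0) C` (`integral_mul_dipole`). Both hold because dilating the profile changes the integral by
the pairing of `h` with a divergence to which it is orthogonal, while the dilated weights
concentrate at the origin.

Since `|h| < 1` and `w ≥ 0`, adding `h(0)` times the first identity to the second gives `∂ₑh(0) C +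
h(0)² W = ∫ h (⟪e, x⟫ + h(0)) w ≤ ∫ |⟪e, x⟫ + h(0)| w`. On the unit sphere of `ℝ³` the coordinate
`⟪e, x⟫` is uniform on `[-1, 1]` (Archimedes), and there the mean of `|u + t|` is `(1 + t²)/2`.
Smaller radii and higher dimensions only push `⟪e, x⟫` towards `0`, so this value is an upper bound
(`integral_abs_inner_sub_mul_le`). Hence `∂ₑh(0) C ≤ (1 - h(0)²) W / 2`.

If `w` vanishes for `s < a`, a further divergence identity gives `a W ≤ 2(n - 1) C`. So `a ∂ₑh(0) ≤
(n - 1)(1 - h(0)²)` (`mul_fderiv_zero_le`), and `a → 1` finishes the estimate at the origin. -/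

/-- `g` is integrable and its integral vanishes. -/
structure IntegratesToZero {n : ℕ} (g : EuclideanSpace ℝ (Fin n) → ℝ) : Prop where
  integrable : Integrable g
  integral_eq : ∫ x, g x = 0

namespace IntegratesToZero

variable {n : ℕ} {f g : EuclideanSpace ℝ (Fin n) → ℝ}

theorem congr (hf : IntegratesToZero f) (hfg : ∀ x, f x = g x) : IntegratesToZero g := by
  rwa [← funext hfg]

theorem add (hf : IntegratesToZero f) (hg : IntegratesToZero g) :
    IntegratesToZero fun x => f x + g x :=
  ⟨hf.1.add hg.1, by rw [integral_add hf.1 hg.1, hf.2, hg.2, add_zero]⟩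

theorem sub (hf : IntegratesToZero f) (hg : IntegratesToZero g) :
    IntegratesToZero fun x => f x - g x :=
  ⟨hf.1.sub hg.1, by rw [integral_sub hf.1 hg.1, hf.2, hg.2, sub_zero]⟩

theorem sum {ι : Type*} [Fintype ι] {f : ι → EuclideanSpace ℝ (Fin n) → ℝ}
    (hf : ∀ i, IntegratesToZero (f i)) : IntegratesToZero fun x => ∑ i, f i x :=
  ⟨integrable_finsetSum _ fun i _ => (hf i).1, by
    rw [integral_finsetSum _ fun i _ => (hf i).1]
    exact Finset.sum_eq_zero fun i _ => (hf i).2⟩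

end IntegratesToZero

/-! ### Divergence identities for functions supported inside the ball. -/

section CompactlySupported

variable {n : ℕ} {b : ℝ} {f : EuclideanSpace ℝ (Fin n) → ℝ}

theorem norm_lt_one_of_sq_le {F : Type*} [NormedAddCommGroup F] {x : F} (hb : b < 1)
    (hx : ‖x‖ ^ 2 ≤ b) : ‖x‖ < 1 := by
  by_contra! h
  nlinarith [norm_nonneg x]

theorem eventually_lt_norm_sq {F : Type*} [NormedAddCommGroup F] {x : F} (hx : b < ‖x‖ ^ 2) :
    ∀ᶠ y in 𝓝 x, b < ‖y‖ ^ 2 :=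
  (continuous_norm.pow 2).continuousAt.eventually (lt_mem_nhds hx)

/-- The function `h` is arbitrary off the ball, so products of `h` with cutoffs are only known to be
smooth inside. As `b < 1`, the ball and the open set `b < |x|²` cover the space, and global
smoothness follows. -/
theorem contDiff_of_contDiffOn_ball {k : ℕ∞} (hb : b < 1) (hf : ContDiffOn ℝ k f (ball 0 1))
    (hz : ∀ x, b < ‖x‖ ^ 2 → f x = 0) : ContDiff ℝ k f := by
  rw [contDiff_iff_contDiffAt]
  intro x
  rcases le_or_gt (‖x‖ ^ 2) b with hx | hx
  · exact hf.contDiffAt (isOpen_ball.mem_nhds (by simpa using norm_lt_one_of_sq_le hb hx))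
  · exact contDiffAt_const.congr_of_eventuallyEq
      ((eventually_lt_norm_sq hx).mono fun y hy => hz y hy)

theorem continuous_of_continuousOn_ball (hb : b < 1) (hf : ContinuousOn f (ball 0 1))
    (hz : ∀ x, b < ‖x‖ ^ 2 → f x = 0) : Continuous f :=
  (contDiff_of_contDiffOn_ball (k := 0) hb (by simpa [contDiffOn_zero] using hf) hz).continuous

theorem hasCompactSupport_of_vanishing (hb : b < 1) (hz : ∀ x, b < ‖x‖ ^ 2 → f x = 0) :
    HasCompactSupport f := by
  refine HasCompactSupport.of_support_subset_isCompact (isCompact_closedBall 0 1) fun x hx => ?_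
  by_contra h
  refine hx (hz x ?_)
  by_contra! h'
  exact h (by simpa using (norm_lt_one_of_sq_le hb h').le)

theorem integrable_of_continuousOn_ball (hb : b < 1) (hf : ContinuousOn f (ball 0 1))
    (hz : ∀ x, b < ‖x‖ ^ 2 → f x = 0) : Integrable f :=
  (continuous_of_continuousOn_ball hb hf hz).integrable_of_hasCompactSupport
    (hasCompactSupport_of_vanishing hb hz)

theorem fderiv_eq_zero_of_vanishing (hz : ∀ x, b < ‖x‖ ^ 2 → f x = 0)
    (x : EuclideanSpace ℝ (Fin n)) (hx : b < ‖x‖ ^ 2) : fderiv ℝ f x = 0 := by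
  have : f =ᶠ[𝓝 x] fun _ => 0 := (eventually_lt_norm_sq hx).mono fun y hy => hz y hy
  rw [this.fderiv_eq]; simp

theorem integratesToZero_fderiv_apply (hb : b < 1) (hf : ContDiffOn ℝ 1 f (ball 0 1))
    (hz : ∀ x, b < ‖x‖ ^ 2 → f x = 0) (v : EuclideanSpace ℝ (Fin n)) :
    IntegratesToZero fun x => fderiv ℝ f x v := by
  have hfc : ContDiff ℝ 1 f := contDiff_of_contDiffOn_ball (k := 1) hb hf hz
  have hintegrable : Integrable fun x => fderiv ℝ f x v :=
    integrable_of_continuousOn_ball hb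
      ((hfc.continuous_fderiv one_ne_zero).clm_apply continuous_const).continuousOn
      fun x hx => by simp [fderiv_eq_zero_of_vanishing hz x hx]
  have := integral_mul_fderiv_eq_neg_fderiv_mul_of_integrable (𝕜 := ℝ) (μ := volume)
    (f := fun _ : EuclideanSpace ℝ (Fin n) => (1 : ℝ)) (g := f) (v := v) (by simp)
    (by simpa using hintegrable)
    (by simpa using integrable_of_continuousOn_ball hb hfc.continuous.continuousOn hz)
    (fun x _ => by fun_prop) (fun x _ => hfc.differentiable one_ne_zero x)
  exact ⟨hintegrable, by simpa using this⟩

/-- The values of a linear form on the coordinate vectors determine it. -/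
theorem sum_coord_mul_apply_single (L : EuclideanSpace ℝ (Fin n) →L[ℝ] ℝ)
    (v : EuclideanSpace ℝ (Fin n)) : ∑ i, v i * L (EuclideanSpace.single i 1) = L v := by
  conv_rhs => rw [← (EuclideanSpace.basisFun (Fin n) ℝ).sum_repr v]
  simp [map_sum]

theorem hasFDerivAt_coord (i : Fin n) (x : EuclideanSpace ℝ (Fin n)) :
    HasFDerivAt (fun x : EuclideanSpace ℝ (Fin n) => x i)
      (EuclideanSpace.proj i : EuclideanSpace ℝ (Fin n) →L[ℝ] ℝ) x :=
  (EuclideanSpace.proj i : EuclideanSpace ℝ (Fin n) →L[ℝ] ℝ).hasFDerivAt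

theorem contDiff_coord {k : WithTop ℕ∞} (i : Fin n) :
    ContDiff ℝ k (fun x : EuclideanSpace ℝ (Fin n) => x i) :=
  (EuclideanSpace.proj i : EuclideanSpace ℝ (Fin n) →L[ℝ] ℝ).contDiff

/-- The divergence theorem for the radial field `f(x) x`. -/
theorem integratesToZero_fderiv_apply_self_add (hb : b < 1) (hf : ContDiffOn ℝ 1 f (ball 0 1))
    (hz : ∀ x, b < ‖x‖ ^ 2 → f x = 0) :
    IntegratesToZero fun x => fderiv ℝ f x x + n * f x := by
  have hfc : ContDiff ℝ 1 f := contDiff_of_contDiffOn_ball (k := 1) hb hf hz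
  have hg : ∀ i : Fin n, ContDiff ℝ 1 fun x : EuclideanSpace ℝ (Fin n) => x i * f x :=
    fun i => (contDiff_coord i).mul hfc
  have hgz : ∀ i : Fin n, ∀ x : EuclideanSpace ℝ (Fin n), b < ‖x‖ ^ 2 → x i * f x = 0 :=
    fun i x hx => by simp [hz x hx]
  have key : ∀ x : EuclideanSpace ℝ (Fin n), fderiv ℝ f x x + n * f x =
      ∑ i, fderiv ℝ (fun y : EuclideanSpace ℝ (Fin n) => y i * f y) x
        (EuclideanSpace.single i 1) := by
    intro x
    have : ∀ i : Fin n, fderiv ℝ (fun y : EuclideanSpace ℝ (Fin n) => y i * f y) x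
        (EuclideanSpace.single i 1) =
        x i * fderiv ℝ f x (EuclideanSpace.single i 1) + f x := by
      intro i
      rw [((hasFDerivAt_coord i x).fun_mul (hfc.differentiable one_ne_zero x).hasFDerivAt).fderiv]
      simp
    simp_rw [this, Finset.sum_add_distrib, sum_coord_mul_apply_single]
    simp
  exact (IntegratesToZero.sum fun i =>
    integratesToZero_fderiv_apply hb (hg i).contDiffOn (hgz i) _).congr fun x => (key x).symm

end CompactlySupported

/-! ### The equation `Δ_h h = 0` in first-order and weak form. -/

theorem hasFDerivAt_norm_sq' {n : ℕ} (x : EuclideanSpace ℝ (Fin n)) :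
    HasFDerivAt (fun x : EuclideanSpace ℝ (Fin n) => ‖x‖ ^ 2) (2 • innerSL ℝ x) x :=
  (hasStrictFDerivAt_norm_sq x).hasFDerivAt

theorem laplacian_eq_sum_fderiv_fderiv {n : ℕ} (h : EuclideanSpace ℝ (Fin n) → ℝ)
    (x : EuclideanSpace ℝ (Fin n)) : Laplacian.laplacian h x =
      ∑ i, fderiv ℝ (fderiv ℝ h) x (EuclideanSpace.single i 1) (EuclideanSpace.single i 1) := by
  have := laplacian_eq_iteratedFDeriv_orthonormalBasis h (EuclideanSpace.basisFun (Fin n) ℝ)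
  rw [this]
  simp [iteratedFDeriv_two_apply]

theorem IsHyperbolicHarmonic.laplacian_eq {n : ℕ} {h : EuclideanSpace ℝ (Fin n) → ℝ}
    (hh : IsHyperbolicHarmonic h) {x : EuclideanSpace ℝ (Fin n)} (hx : ‖x‖ < 1) :
    (1 - ‖x‖ ^ 2) * Laplacian.laplacian h x = -(2 * ((n : ℝ) - 2) * fderiv ℝ h x x) := by
  have h0 := hh.2 x (by simpa [unitBall] using hx)
  rw [hyperbolicLaplacian, sum_coord_mul_apply_single] at h0
  have hpos : 0 < 1 - ‖x‖ ^ 2 := by nlinarith [norm_nonneg x]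
  have : (1 - ‖x‖ ^ 2) * ((1 - ‖x‖ ^ 2) * Laplacian.laplacian h x
      + 2 * ((n : ℝ) - 2) * fderiv ℝ h x x) = 0 := by linear_combination h0
  rcases mul_eq_zero.1 this with h1 | h1 <;> linarith

theorem IsHyperbolicHarmonic.contDiffOn_fderiv {n : ℕ} {h : EuclideanSpace ℝ (Fin n) → ℝ}
    (hh : IsHyperbolicHarmonic h) : ContDiffOn ℝ 1 (fderiv ℝ h) (ball 0 1) :=
  hh.1.fderiv_of_isOpen isOpen_ball (by norm_num)

/-- The weak form of the equation `Δ_h h = 0`. -/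
theorem IsHyperbolicHarmonic.integratesToZero_weak {n : ℕ} {h θ : EuclideanSpace ℝ (Fin n) → ℝ} {b : ℝ}
    (hh : IsHyperbolicHarmonic h) (hb : b < 1) (hθ : ContDiffOn ℝ 1 θ (ball 0 1))
    (hz : ∀ x, b < ‖x‖ ^ 2 → θ x = 0) :
    IntegratesToZero fun x => (1 - ‖x‖ ^ 2) * ∑ i, fderiv ℝ θ x (EuclideanSpace.single i 1)
        * fderiv ℝ h x (EuclideanSpace.single i 1)
      - 2 * ((n : ℝ) - 1) * (θ x * fderiv ℝ h x x) := by
  set e : Fin n → EuclideanSpace ℝ (Fin n) := fun i => EuclideanSpace.single i 1 with he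
  have hD := hh.contDiffOn_fderiv
  -- These are the components of `ρ θ ∇h`. In its divergence, `ρ Δh = -2(n - 2) x·∇h` joins the `-2
  -- x·∇h` from `∇ρ`, whence the coefficient `-2(n - 1)`.
  set V : Fin n → EuclideanSpace ℝ (Fin n) → ℝ :=
    fun i x => (1 - ‖x‖ ^ 2) * (θ x * fderiv ℝ h x (e i)) with hVdef
  have hV : ∀ i, ContDiffOn ℝ 1 (V i) (ball 0 1) := fun i =>
    (contDiff_const.sub (contDiff_norm_sq ℝ)).contDiffOn.mul
      (hθ.mul (hD.clm_apply contDiffOn_const))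
  have hVz : ∀ i x, b < ‖x‖ ^ 2 → V i x = 0 := fun i x hx => by simp [V, hz x hx]
  have key : ∀ x : EuclideanSpace ℝ (Fin n),
      ((1 - ‖x‖ ^ 2) * ∑ i, fderiv ℝ θ x (e i) * fderiv ℝ h x (e i)
        - 2 * ((n : ℝ) - 1) * (θ x * fderiv ℝ h x x)) = ∑ i, fderiv ℝ (V i) x (e i) := by
    intro x
    rcases lt_or_ge (b) (‖x‖ ^ 2) with hx | hx
    · simp [fderiv_eq_zero_of_vanishing hz x hx, hz x hx,
        fun i => fderiv_eq_zero_of_vanishing (hVz i) x hx]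
    have hx1 : ‖x‖ < 1 := norm_lt_one_of_sq_le hb hx
    have hxb : ball (0 : EuclideanSpace ℝ (Fin n)) 1 ∈ 𝓝 x :=
      isOpen_ball.mem_nhds (by simpa using hx1)
    have hθx := ((hθ.contDiffAt hxb).differentiableAt one_ne_zero).hasFDerivAt
    have hDx := ((hD.contDiffAt hxb).differentiableAt one_ne_zero).hasFDerivAt
    have hVi : ∀ i, fderiv ℝ (V i) x (e i) =
        (1 - ‖x‖ ^ 2) * (fderiv ℝ θ x (e i) * fderiv ℝ h x (e i))
        + (1 - ‖x‖ ^ 2) * θ x * fderiv ℝ (fderiv ℝ h) x (e i) (e i)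
        - 2 * θ x * (x i * fderiv ℝ h x (e i)) := by
      intro i
      have h1 : HasFDerivAt (fun y => fderiv ℝ h y (e i))
          ((fderiv ℝ (fderiv ℝ h) x).flip (e i)) x := by
        simpa using hDx.clm_apply (hasFDerivAt_const (e i) x)
      have h2 := ((hasFDerivAt_norm_sq' x).const_sub 1).mul (hθx.mul h1)
      have h3 : V i = (fun y => 1 - ‖y‖ ^ 2) * (θ * fun y => fderiv ℝ h y (e i)) := by
        ext y; rfl
      rw [h3, h2.fderiv]
      simp [he, EuclideanSpace.inner_single_right]
      ring
    simp_rw [hVi, Finset.sum_sub_distrib, Finset.sum_add_distrib, ← Finset.mul_sum, he,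
      sum_coord_mul_apply_single, ← laplacian_eq_sum_fderiv_fderiv]
    linear_combination (-θ x) * hh.laplacian_eq hx1
  exact (IntegratesToZero.sum fun i =>
    integratesToZero_fderiv_apply hb (hV i) (hVz i) _).congr fun x => (key x).symm

/-! ### Kernels orthogonal to hyperbolic harmonic functions. -/

section RadialTests

variable {n : ℕ} {h : EuclideanSpace ℝ (Fin n) → ℝ} {b : ℝ} {q q₁ q₂ : ℝ → ℝ}

theorem hasFDerivAt_radial {x : EuclideanSpace ℝ (Fin n)} {c : ℝ}
    (hq : HasDerivAt q c (‖x‖ ^ 2)) :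
    HasFDerivAt (fun x : EuclideanSpace ℝ (Fin n) => q (‖x‖ ^ 2)) (c • 2 • innerSL ℝ x) x :=
  hq.comp_hasFDerivAt x (hasFDerivAt_norm_sq' x)

theorem hasFDerivAt_inner_left (e x : EuclideanSpace ℝ (Fin n)) :
    HasFDerivAt (fun x : EuclideanSpace ℝ (Fin n) => inner ℝ e x) (innerSL ℝ e) x :=
  (innerSL ℝ e).hasFDerivAt

theorem contDiff_one_of_hasDerivAt (hq : ∀ s, HasDerivAt q (q₁ s) s) (hc : Continuous q₁) :
    ContDiff ℝ 1 q := by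
  rw [contDiff_one_iff_deriv]
  refine ⟨fun s => (hq s).differentiableAt, ?_⟩
  rwa [show deriv q = q₁ from funext fun s => (hq s).deriv]

theorem hasDerivAt_eq_zero_of_vanishing (hq : ∀ s, HasDerivAt q (q₁ s) s)
    (hz : ∀ s, b < s → q s = 0) (s : ℝ) (hs : b < s) : q₁ s = 0 := by
  have : q =ᶠ[𝓝 s] fun _ => 0 := (lt_mem_nhds hs).mono fun y hy => hz y hy
  exact (hq s).unique ((hasDerivAt_const s (0 : ℝ)).congr_of_eventuallyEq this)

theorem IsHyperbolicHarmonic.differentiableAt (hh : IsHyperbolicHarmonic h)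
    {x : EuclideanSpace ℝ (Fin n)} (hx : ‖x‖ < 1) : DifferentiableAt ℝ h x :=
  (hh.1.contDiffAt (isOpen_ball.mem_nhds (by simpa using hx))).differentiableAt two_ne_zero

theorem IsHyperbolicHarmonic.contDiffOn_one (hh : IsHyperbolicHarmonic h) :
    ContDiffOn ℝ 1 h (ball 0 1) := hh.1.of_le one_le_two

theorem sum_inner_mul_apply_single (L : EuclideanSpace ℝ (Fin n) →L[ℝ] ℝ)
    (v : EuclideanSpace ℝ (Fin n)) :
    ∑ i, inner ℝ v (EuclideanSpace.single i 1) * L (EuclideanSpace.single i 1) = L v := by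
  simpa [EuclideanSpace.inner_single_right] using sum_coord_mul_apply_single L v

/-- A hyperbolic harmonic function is orthogonal to the divergence of the fields
`ρ^(2-n) ∇(ρ^(n-1) ⟪e, x⟫ q(|x|²))`, where `ρ = 1 - |x|²`. -/
theorem IsHyperbolicHarmonic.integratesToZero_dipole (hh : IsHyperbolicHarmonic h) (hb : b < 1)
    (hq : ∀ s, HasDerivAt q (q₁ s) s) (hq₁ : ∀ s, HasDerivAt q₁ (q₂ s) s) (hq₂ : Continuous q₂)
    (hz : ∀ s, b < s → q s = 0) (e : EuclideanSpace ℝ (Fin n)) :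
    IntegratesToZero fun x => h x * (inner ℝ e x *
      (2 * n * (n * q (‖x‖ ^ 2) + 2 * ‖x‖ ^ 2 * q₁ (‖x‖ ^ 2))
        - 2 * (1 - ‖x‖ ^ 2) * ((n + 2) * q₁ (‖x‖ ^ 2) + 2 * ‖x‖ ^ 2 * q₂ (‖x‖ ^ 2)))) := by
  have hz₁ := hasDerivAt_eq_zero_of_vanishing hq hz
  have hz₂ := hasDerivAt_eq_zero_of_vanishing hq₁ hz₁
  have hq₁c := contDiff_one_of_hasDerivAt hq₁ hq₂
  have hqc := contDiff_one_of_hasDerivAt hq hq₁c.continuous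
  have hn := contDiff_norm_sq ℝ (E := EuclideanSpace ℝ (Fin n)) (n := 1)
  have hin : ContDiff ℝ 1 fun x : EuclideanSpace ℝ (Fin n) => inner ℝ e x :=
    (innerSL ℝ e).contDiff
  have zA : ∀ x : EuclideanSpace ℝ (Fin n), b < ‖x‖ ^ 2 → inner ℝ e x * q (‖x‖ ^ 2) = 0 :=
    fun x hx => by simp [hz _ hx]
  have z1 : ∀ x, b < ‖x‖ ^ 2 → h x * ((1 - ‖x‖ ^ 2) * q (‖x‖ ^ 2)) = 0 :=
    fun x hx => by simp [hz _ hx]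
  have z2 : ∀ x, b < ‖x‖ ^ 2 → h x * ((2 * (1 - ‖x‖ ^ 2) * q₁ (‖x‖ ^ 2)
      - 2 * (n - 1) * q (‖x‖ ^ 2)) * inner ℝ e x) = 0 :=
    fun x hx => by simp [hz _ hx, hz₁ _ hx]
  have hA := hh.integratesToZero_weak (θ := fun x => inner ℝ e x * q (‖x‖ ^ 2)) hb
    (hin.mul (hqc.comp hn)).contDiffOn zA
  have h1 := integratesToZero_fderiv_apply (f := fun x => h x * ((1 - ‖x‖ ^ 2) * q (‖x‖ ^ 2)))
    hb (hh.contDiffOn_one.mul ((contDiff_const.sub hn).mul (hqc.comp hn)).contDiffOn)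
    z1 e
  have h2 := integratesToZero_fderiv_apply_self_add
    (f := fun x => h x * ((2 * (1 - ‖x‖ ^ 2) * q₁ (‖x‖ ^ 2) - 2 * (n - 1) * q (‖x‖ ^ 2))
      * inner ℝ e x)) hb
    (hh.contDiffOn_one.mul ((((contDiff_const.mul (contDiff_const.sub hn)).mul
      (hq₁c.comp hn)).sub (contDiff_const.mul (hqc.comp hn))).mul hin).contDiffOn)
    z2
  -- With `θ = ⟪e, x⟫ q`, the field is `F = ρ ∇θ - 2(n - 1) θ x = ρ q e + (2ρ q' - 2(n - 1) q) ⟪e,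
  -- x⟫ x`. Here `hA` is `F·∇h`, while `h1` and `h2` make up `div (h F)`; the difference is `-h div
  -- F`.
  refine ((hA.sub h1).sub h2).congr fun x => ?_
  rcases lt_or_ge b (‖x‖ ^ 2) with hx | hx
  · rw [fderiv_eq_zero_of_vanishing zA x hx, fderiv_eq_zero_of_vanishing z1 x hx,
      fderiv_eq_zero_of_vanishing z2 x hx]
    simp [hz _ hx, hz₁ _ hx, hz₂ _ hx]
  have hx1 : ‖x‖ < 1 := norm_lt_one_of_sq_le hb hx
  have dh := (hh.differentiableAt hx1).hasFDerivAt
  have dq := hasFDerivAt_radial (hq (‖x‖ ^ 2))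
  have dq₁ := hasFDerivAt_radial (hq₁ (‖x‖ ^ 2))
  have dn := hasFDerivAt_norm_sq' x
  have di := hasFDerivAt_inner_left e x
  rw [(di.fun_mul dq).fderiv, (dh.fun_mul ((dn.const_sub 1).fun_mul dq)).fderiv,
    (dh.fun_mul (((((dn.const_sub 1).const_mul 2).fun_mul dq₁).fun_sub
      (dq.const_mul (2 * (n - 1)))).fun_mul di)).fderiv]
  have hsum : ∑ i, (inner ℝ e x • q₁ (‖x‖ ^ 2) • 2 • innerSL ℝ x + q (‖x‖ ^ 2) • innerSL ℝ e)
      (EuclideanSpace.single i 1) * fderiv ℝ h x (EuclideanSpace.single i 1) =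
      2 * inner ℝ e x * q₁ (‖x‖ ^ 2) * fderiv ℝ h x x + q (‖x‖ ^ 2) * fderiv ℝ h x e := by
    rw [← sum_inner_mul_apply_single _ x, ← sum_inner_mul_apply_single _ e, Finset.mul_sum,
      Finset.mul_sum, ← Finset.sum_add_distrib]
    refine Finset.sum_congr rfl fun i _ => ?_
    simp
    ring
  rw [hsum]
  simp only [add_apply, sub_apply,
    neg_apply, smul_apply, innerSL_apply_apply,
    real_inner_self_eq_norm_sq, real_inner_comm e x, smul_eq_mul, nsmul_eq_mul]
  push_cast
  ring

/-- A hyperbolic harmonic function is orthogonal to the divergence of compactly supported radial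
fields `q(|x|²) x`. -/
theorem IsHyperbolicHarmonic.integratesToZero_monopole (hh : IsHyperbolicHarmonic h)
    (hn2 : 2 ≤ n) (hb : b < 1) (hq : ∀ s, HasDerivAt q (q₁ s) s) (hq₁ : Continuous q₁)
    (hz : ∀ s, b < s → q s = 0) :
    IntegratesToZero fun x => h x * (n * q (‖x‖ ^ 2) + 2 * ‖x‖ ^ 2 * q₁ (‖x‖ ^ 2)) := by
  obtain ⟨N, hN⟩ : ∃ N, n = N + 2 := ⟨n - 2, by omega⟩
  have hNn : (n : ℝ) = N + 2 := by rw [hN]; push_cast; ring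
  have hz₁ := hasDerivAt_eq_zero_of_vanishing hq hz
  have hqc := contDiff_one_of_hasDerivAt hq hq₁
  have hn := contDiff_norm_sq ℝ (E := EuclideanSpace ℝ (Fin n)) (n := 1)
  -- The aim is `θ = k(|x|²)` with `ρ^(2-n) ∇(ρ^(n-1) θ) = q x`. For `K = (1 - s)^(n-1) k` this
  -- reads `K' = (1 - s)^(n-2) q / 2`. Integrating from `1`, rather than from `0`, makes `K` vanish
  -- for `s > b`.
  set p : ℝ → ℝ := fun s => (1 - s) ^ N * q s / 2 with hp
  have hpc : Continuous p := by
    have := hqc.continuous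
    fun_prop
  set K : ℝ → ℝ := fun s => ∫ τ in (1 : ℝ)..s, p τ with hK
  have hKd : ∀ s, HasDerivAt K (p s) s := fun s => hpc.integral_hasStrictDerivAt 1 s |>.hasDerivAt
  have hKc := contDiff_one_of_hasDerivAt hKd hpc
  have hKz : ∀ s, b < s → K s = 0 := fun s hs => by
    refine (intervalIntegral.integral_congr (g := fun _ => (0 : ℝ)) fun τ hτ => ?_).trans (by simp)
    have : b < τ := lt_of_lt_of_le (lt_min hb hs) hτ.1
    simp [hp, hz τ this]
  set k : ℝ → ℝ := fun s => K s * ((1 - s) ^ (N + 1))⁻¹ with hk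
  have hkd : ∀ s, s < 1 → HasDerivAt k
      (p s * ((1 - s) ^ (N + 1))⁻¹ + K s * ((N + 1) / (1 - s) ^ (N + 2))) s := by
    intro s hs
    have h0 : 1 - s ≠ 0 := by linarith
    refine ((hKd s).fun_mul ((((hasDerivAt_id s).const_sub 1).fun_pow (N + 1)).fun_inv
      (pow_ne_zero _ h0))).congr_deriv ?_
    simp
    field_simp
    exact Or.inl (by ring)
  have hθ : ContDiffOn ℝ 1 (fun x : EuclideanSpace ℝ (Fin n) => k (‖x‖ ^ 2)) (ball 0 1) := by
    refine (hKc.comp hn).contDiffOn.mul (ContDiffOn.inv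
      ((contDiff_const.sub hn).pow (N + 1)).contDiffOn fun x hx => pow_ne_zero _ ?_)
    have : ‖x‖ < 1 := by simpa using hx
    nlinarith [norm_nonneg x]
  have hθz : ∀ x : EuclideanSpace ℝ (Fin n), b < ‖x‖ ^ 2 → k (‖x‖ ^ 2) = 0 :=
    fun x hx => by simp [hk, hKz _ hx]
  have hA := hh.integratesToZero_weak hb hθ hθz
  have h2 := integratesToZero_fderiv_apply_self_add (f := fun x => h x * q (‖x‖ ^ 2)) hb
    (hh.contDiffOn_one.mul (hqc.comp hn).contDiffOn) (fun x hx => by simp [hz _ hx])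
  refine (h2.sub hA).congr fun x => ?_
  rcases lt_or_ge b (‖x‖ ^ 2) with hx | hx
  · rw [fderiv_eq_zero_of_vanishing hθz x hx,
      fderiv_eq_zero_of_vanishing (fun x hx => by simp [hz _ hx]) x hx]
    simp [hz _ hx, hz₁ _ hx, hθz x hx]
  have hx1 : ‖x‖ < 1 := norm_lt_one_of_sq_le hb hx
  have hs : ‖x‖ ^ 2 < 1 := lt_of_le_of_lt hx hb
  have h0 : 1 - ‖x‖ ^ 2 ≠ 0 := by linarith
  have dh := (hh.differentiableAt hx1).hasFDerivAt
  have dq := hasFDerivAt_radial (hq (‖x‖ ^ 2))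
  have dk := hasFDerivAt_radial (hkd (‖x‖ ^ 2) hs)
  rw [(dh.fun_mul dq).fderiv, dk.fderiv]
  simp only [add_apply,
    smul_apply, innerSL_apply_apply,
    real_inner_self_eq_norm_sq, smul_eq_mul, nsmul_eq_mul]
  simp_rw [mul_assoc, ← Finset.mul_sum, sum_inner_mul_apply_single]
  simp only [hk, hp, hNn]
  push_cast
  field_simp
  ring

end RadialTests

/-! ### Mean value and derivative formulas by dilation of the weight. -/

section Kernels

variable {n : ℕ} {h g : EuclideanSpace ℝ (Fin n) → ℝ} {b : ℝ} {m m₁ m₂ : ℝ → ℝ}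

theorem isCompact_norm_sq_le (hb : b < 1) :
    IsCompact {x : EuclideanSpace ℝ (Fin n) | ‖x‖ ^ 2 ≤ b} :=
  (isCompact_closedBall (0 : EuclideanSpace ℝ (Fin n)) 1).of_isClosed_subset
    (isClosed_le (by fun_prop) continuous_const)
    fun x hx => by simpa using (norm_lt_one_of_sq_le hb hx).le

theorem norm_sq_le_subset_ball (hb : b < 1) :
    {x : EuclideanSpace ℝ (Fin n) | ‖x‖ ^ 2 ≤ b} ⊆ ball 0 1 :=
  fun x hx => by simpa using norm_lt_one_of_sq_le hb hx

/-- If the derivatives of a family of kernels are orthogonal to `h`, then pairing with `h` is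
constant along the family. -/
theorem integral_mul_kernel_eq {N K : ℝ → EuclideanSpace ℝ (Fin n) → ℝ} {β : ℝ}
    (hh : ContinuousOn h (ball 0 1)) (hβ : β < 1)
    (hN : ∀ μ x, HasDerivAt (fun ν => N ν x) (K μ x) μ) (hNc : ∀ μ, Continuous (N μ))
    (hK : Continuous fun p : ℝ × EuclideanSpace ℝ (Fin n) => K p.1 p.2)
    (hNz : ∀ μ, β < μ → ∀ x, β < ‖x‖ ^ 2 → N μ x = 0)
    (hKz : ∀ μ, β < μ → ∀ x, β < ‖x‖ ^ 2 → K μ x = 0)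
    (h0 : ∀ μ, 1 ≤ μ → IntegratesToZero fun x => h x * K μ x) {μ : ℝ} (hμ : 1 ≤ μ) :
    ∫ x, h x * N μ x = ∫ x, h x * N 1 x := by
  have hintegrable : ∀ μ, β < μ → Integrable fun x => h x * N μ x := fun μ hμ =>
    integrable_of_continuousOn_ball hβ (hh.mul (hNc μ).continuousOn)
      fun x hx => by simp [hNz μ hμ x hx]
  have hder : ∀ μ, 1 ≤ μ → HasDerivAt (fun ν => ∫ x, h x * N ν x) 0 μ := by
    intro μ hμ
    -- Since `β < 1 ≤ μ`, there is room for a two-sided derivative even at `μ = 1`, with all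
    -- supports kept in one compact subset of the ball.
    obtain ⟨C, hC⟩ := ((isCompact_Icc (a := β) (b := μ + 1)).prod
      (isCompact_norm_sq_le (n := n) hβ)).exists_bound_of_continuousOn hK.continuousOn
    set S := {x : EuclideanSpace ℝ (Fin n) | ‖x‖ ^ 2 ≤ β} with hS
    have hbound : Integrable (S.indicator fun x => ‖h x‖ * C) := by
      rw [integrable_indicator_iff (isCompact_norm_sq_le hβ).measurableSet]
      exact ((hh.mono (norm_sq_le_subset_ball hβ)).norm.mul
        continuousOn_const).integrableOn_compact (isCompact_norm_sq_le hβ)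
    have := hasDerivAt_integral_of_dominated_loc_of_deriv_le (μ := volume)
      (F := fun ν x => h x * N ν x) (F' := fun ν x => h x * K ν x) (x₀ := μ)
      (s := Ioo β (μ + 1)) (Ioo_mem_nhds (by linarith) (by linarith))
      (bound := S.indicator fun x => ‖h x‖ * C)
      ((lt_mem_nhds (show β < μ by linarith)).mono fun ν hν => (hintegrable ν hν).1)
      (hintegrable μ (by linarith)) (h0 μ hμ).1.1
      (.of_forall fun x ν hν => ?_) hbound
      (.of_forall fun x ν hν => (hN ν x).const_mul (h x))
    · simpa [(h0 μ hμ).2] using this.2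
    · by_cases hx : x ∈ S
      · rw [indicator_of_mem hx, norm_mul]
        exact mul_le_mul_of_nonneg_left (hC (ν, x) ⟨⟨hν.1.le, hν.2.le⟩, hx⟩) (norm_nonneg _)
      · rw [indicator_of_notMem hx]
        simp [hKz ν hν.1 x (not_le.1 hx)]
  exact constant_of_has_deriv_right_zero (f := fun ν => ∫ x, h x * N ν x) (a := 1) (b := μ)
    (fun ν hν => (hder ν hν.1).continuousAt.continuousWithinAt)
    (fun ν hν => (hder ν hν.1).hasDerivWithinAt) μ ⟨hμ, le_rfl⟩

/-- The dilated weights have constant mass and shrink to the origin; after the substitution `x ↦ μ⁻¹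
x`, this is dominated convergence. -/
theorem tendsto_integral_mul_dilated_kernel (hg : ContinuousOn g (ball 0 1)) (hb : b < 1)
    (hm : Continuous m) (hz : ∀ s, b < s → m s = 0) :
    Tendsto (fun μ : ℝ => ∫ x, g x * (μ ^ n * m (μ ^ 2 * ‖x‖ ^ 2))) atTop
      (𝓝 (g 0 * ∫ x : EuclideanSpace ℝ (Fin n), m (‖x‖ ^ 2))) := by
  have hscale : ∀ μ : ℝ, 1 ≤ μ → ∫ x, g (μ⁻¹ • x) * m (‖x‖ ^ 2) =
      ∫ x, g x * (μ ^ n * m (μ ^ 2 * ‖x‖ ^ 2)) := by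
    intro μ hμ
    have hμ0 : 0 < μ := by linarith
    have := Measure.integral_comp_smul (volume : Measure (EuclideanSpace ℝ (Fin n)))
      (fun x => g (μ⁻¹ • x) * m (‖x‖ ^ 2)) μ
    rw [finrank_euclideanSpace_fin, abs_of_pos (by positivity), smul_eq_mul] at this
    have h2 : ∫ x, g (μ⁻¹ • x) * m (‖x‖ ^ 2) = μ ^ n *
        ∫ x : EuclideanSpace ℝ (Fin n), g (μ⁻¹ • μ • x) * m (‖μ • x‖ ^ 2) := by
      rw [this]; field_simp
    rw [h2, ← integral_const_mul]
    refine integral_congr_ae (.of_forall fun x => ?_)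
    simp only [smul_smul, inv_mul_cancel₀ hμ0.ne', one_smul, norm_smul, Real.norm_eq_abs,
      abs_of_pos hμ0, mul_pow]
    ring
  refine Tendsto.congr' ((eventually_ge_atTop 1).mono hscale) ?_
  rw [← integral_const_mul]
  obtain ⟨C, hC⟩ := (isCompact_norm_sq_le (n := n) hb).exists_bound_of_continuousOn
    (hg.mono (norm_sq_le_subset_ball hb))
  have hmem : ∀ μ : ℝ, 1 ≤ μ → ∀ x : EuclideanSpace ℝ (Fin n), ‖μ⁻¹ • x‖ ≤ ‖x‖ := by
    intro μ hμ x
    rw [norm_smul, norm_inv, Real.norm_eq_abs, abs_of_pos (by linarith)]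
    exact mul_le_of_le_one_left (norm_nonneg x) (inv_le_one_of_one_le₀ hμ)
  have hmint : Integrable fun x : EuclideanSpace ℝ (Fin n) => m (‖x‖ ^ 2) :=
    integrable_of_continuousOn_ball hb (by fun_prop) fun x hx => hz _ hx
  refine tendsto_integral_filter_of_dominated_convergence
    (fun x => C * ‖m (‖x‖ ^ 2)‖) ?_ ?_ (hmint.norm.const_mul C) ?_
  · filter_upwards [eventually_ge_atTop 1] with μ hμ
    refine (integrable_of_continuousOn_ball hb (ContinuousOn.mul (hg.comp (by fun_prop) ?_)
      (by fun_prop)) fun x hx => by simp [hz _ hx]).1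
    intro x hx
    simpa using (hmem μ hμ x).trans_lt (by simpa using hx)
  · filter_upwards [eventually_ge_atTop 1] with μ hμ
    refine .of_forall fun x => ?_
    rcases lt_or_ge b (‖x‖ ^ 2) with hx | hx
    · simp [hz _ hx]
    · rw [norm_mul]
      refine mul_le_mul_of_nonneg_right (hC _ ?_) (norm_nonneg _)
      exact (pow_le_pow_left₀ (norm_nonneg _) (hmem μ hμ x) 2).trans hx
  · refine .of_forall fun x => Tendsto.mul_const _ ?_
    have h1 : Tendsto (fun μ : ℝ => μ⁻¹ • x) atTop (𝓝 0) := by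
      simpa using (tendsto_inv_atTop_zero (𝕜 := ℝ)).smul_const x
    exact ((hg.continuousAt (ball_mem_nhds 0 one_pos)).tendsto).comp h1

/-- For `n = k + 1` and `q(s) = μ^k m(μ² s)` the derivative is `n q + 2 s q'`, which at `s = |x|²`
is the divergence of `q(|x|²) x`. This is what links dilation to the orthogonality relations. -/
theorem hasDerivAt_dilated_kernel (hm : ∀ s, HasDerivAt m (m₁ s) s) (k : ℕ) (s μ : ℝ) :
    HasDerivAt (fun μ : ℝ => μ ^ (k + 1) * m (μ ^ 2 * s))
      ((k + 1) * μ ^ k * m (μ ^ 2 * s) + 2 * s * μ ^ (k + 2) * m₁ (μ ^ 2 * s)) μ := by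
  have h1 : HasDerivAt (fun μ : ℝ => m (μ ^ 2 * s)) (m₁ (μ ^ 2 * s) * (2 * μ * s)) μ :=
    (hm _).comp μ (by simpa using (hasDerivAt_pow 2 μ).mul_const s)
  refine ((hasDerivAt_pow (k + 1) μ).fun_mul h1).congr_deriv ?_
  push_cast
  simp
  ring

theorem exists_between_dilation (hb : b < 1) (hb0 : 0 ≤ b) :
    ∃ β, b ≤ β ∧ β < 1 ∧ ∀ μ s : ℝ, β < μ → β < s → b < μ ^ 2 * s := by
  -- What is needed is `b ≤ β³`, which for the mean `β` of `b, 1, 1` is the AM-GM inequality.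
  refine ⟨(2 + b) / 3, by linarith, by linarith, fun μ s hμ hs => ?_⟩
  have h1 : b ≤ ((2 + b) / 3) ^ 2 * ((2 + b) / 3) := by
    nlinarith [mul_nonneg (sq_nonneg (b - 1)) (show 0 ≤ b + 8 by linarith)]
  have hpos : 0 < (2 + b) / 3 := by linarith
  exact h1.trans_lt (mul_lt_mul'' (pow_lt_pow_left₀ hμ hpos.le two_ne_zero) hs
    (by positivity) hpos.le)

theorem hasDerivAt_scaled (hm : ∀ s, HasDerivAt m (m₁ s) s) (c a : ℝ) (s : ℝ) :
    HasDerivAt (fun s => c * m (a * s)) (c * a * m₁ (a * s)) s := by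
  have h1 : HasDerivAt (fun s => m (a * s)) (m₁ (a * s) * a) s :=
    (hm _).comp s (by simpa using (hasDerivAt_id s).const_mul a)
  exact (h1.const_mul c).congr_deriv (by ring)

/-- The mean value property of hyperbolic harmonic functions. -/
theorem IsHyperbolicHarmonic.integral_mul_radial (hh : IsHyperbolicHarmonic h) (hn2 : 2 ≤ n)
    (hb : b < 1) (hb0 : 0 ≤ b) (hm : ∀ s, HasDerivAt m (m₁ s) s) (hm₁ : Continuous m₁)
    (hz : ∀ s, b < s → m s = 0) :
    ∫ x, h x * m (‖x‖ ^ 2) = h 0 * ∫ x : EuclideanSpace ℝ (Fin n), m (‖x‖ ^ 2) := by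
  obtain ⟨k, rfl⟩ : ∃ k, n = k + 1 := ⟨n - 1, by omega⟩
  obtain ⟨β, -, hβ1, hβ⟩ := exists_between_dilation hb hb0
  have hmc := (contDiff_one_of_hasDerivAt hm hm₁).continuous
  have hz₁ := hasDerivAt_eq_zero_of_vanishing hm hz
  have hcont := hh.contDiffOn_one.continuousOn
  have hconst : ∀ μ : ℝ, 1 ≤ μ → ∫ x, h x * (μ ^ (k + 1) * m (μ ^ 2 * ‖x‖ ^ 2)) =
      ∫ x, h x * m (‖x‖ ^ 2) := by
    intro μ hμ
    have := integral_mul_kernel_eq (h := h) (β := β)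
      (N := fun μ x => μ ^ (k + 1) * m (μ ^ 2 * ‖x‖ ^ 2))
      (K := fun μ x => (k + 1) * μ ^ k * m (μ ^ 2 * ‖x‖ ^ 2)
        + 2 * ‖x‖ ^ 2 * μ ^ (k + 2) * m₁ (μ ^ 2 * ‖x‖ ^ 2)) hcont hβ1
      (fun μ x => hasDerivAt_dilated_kernel hm k _ μ) (fun μ => by fun_prop) (by fun_prop)
      (fun μ hμ x hx => by simp [hz _ (hβ μ _ hμ hx)])
      (fun μ hμ x hx => by simp [hz _ (hβ μ _ hμ hx), hz₁ _ (hβ μ _ hμ hx)]) ?_ hμ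
    · simpa using this
    · intro ν hν
      refine (hh.integratesToZero_monopole hn2 hβ1 (hasDerivAt_scaled hm (ν ^ k) (ν ^ 2))
        (by fun_prop) fun s hs => by simp [hz _ (hβ ν _ (by linarith) hs)]).congr fun x => ?_
      push_cast
      ring
  refine tendsto_nhds_unique (tendsto_const_nhds.congr' ?_)
    (tendsto_integral_mul_dilated_kernel hcont hb hmc hz)
  filter_upwards [eventually_ge_atTop 1] with μ hμ using (hconst μ hμ).symm

/-- The infinitesimal hyperbolic translations `(1 + |x|²) e - 2 ⟪e, x⟫ x`, integrated by parts
against a radial weight. -/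
theorem IsHyperbolicHarmonic.integral_translation_mul_radial (hh : IsHyperbolicHarmonic h)
    (hb : b < 1) (hm : ∀ s, HasDerivAt m (m₁ s) s) (hm₁ : Continuous m₁)
    (hz : ∀ s, b < s → m s = 0) (e : EuclideanSpace ℝ (Fin n)) :
    ∫ x, fderiv ℝ h x ((1 + ‖x‖ ^ 2) • e - (2 * inner ℝ e x) • x) * m (‖x‖ ^ 2) =
      ∫ x, h x * (inner ℝ e x * (2 * n * m (‖x‖ ^ 2)
        - 2 * (1 - ‖x‖ ^ 2) * m₁ (‖x‖ ^ 2))) := by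
  have hz₁ := hasDerivAt_eq_zero_of_vanishing hm hz
  have hmc := contDiff_one_of_hasDerivAt hm hm₁
  have hn := contDiff_norm_sq ℝ (E := EuclideanSpace ℝ (Fin n)) (n := 1)
  have hin : ContDiff ℝ 1 fun x : EuclideanSpace ℝ (Fin n) => inner ℝ e x :=
    (innerSL ℝ e).contDiff
  have hmr := hmc.continuous
  have z1 : ∀ x, b < ‖x‖ ^ 2 → h x * ((1 + ‖x‖ ^ 2) * m (‖x‖ ^ 2)) = 0 :=
    fun x hx => by simp [hz _ hx]
  have z2 : ∀ x, b < ‖x‖ ^ 2 → h x * (2 * inner ℝ e x * m (‖x‖ ^ 2)) = 0 :=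
    fun x hx => by simp [hz _ hx]
  have h1 := integratesToZero_fderiv_apply (f := fun x => h x * ((1 + ‖x‖ ^ 2) * m (‖x‖ ^ 2)))
    hb (hh.contDiffOn_one.mul ((contDiff_const.add hn).mul (hmc.comp hn)).contDiffOn) z1 e
  have h2 := integratesToZero_fderiv_apply_self_add
    (f := fun x => h x * (2 * inner ℝ e x * m (‖x‖ ^ 2))) hb
    (hh.contDiffOn_one.mul ((contDiff_const.mul hin).mul (hmc.comp hn)).contDiffOn) z2
  have h3 : IntegratesToZero fun x =>
      fderiv ℝ h x ((1 + ‖x‖ ^ 2) • e - (2 * inner ℝ e x) • x) * m (‖x‖ ^ 2) -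
      h x * (inner ℝ e x * (2 * n * m (‖x‖ ^ 2) - 2 * (1 - ‖x‖ ^ 2) * m₁ (‖x‖ ^ 2))) := by
    -- For `X = (1 + |x|²) e - 2⟪e, x⟫ x` the left side is `div (h m X)`, and `div X = -2n ⟪e, x⟫`,
    -- `x·X = ρ ⟪e, x⟫`.
    refine (h1.sub h2).congr fun x => ?_
    rcases lt_or_ge b (‖x‖ ^ 2) with hx | hx
    · rw [fderiv_eq_zero_of_vanishing z1 x hx, fderiv_eq_zero_of_vanishing z2 x hx]
      simp [hz _ hx, hz₁ _ hx]
    have dh := (hh.differentiableAt (norm_lt_one_of_sq_le hb hx)).hasFDerivAt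
    have dm := hasFDerivAt_radial (hm (‖x‖ ^ 2))
    have dn := hasFDerivAt_norm_sq' x
    have di := hasFDerivAt_inner_left e x
    rw [(dh.fun_mul ((dn.const_add 1).fun_mul dm)).fderiv,
      (dh.fun_mul ((di.const_mul 2).fun_mul dm)).fderiv]
    simp only [add_apply, smul_apply, innerSL_apply_apply, map_sub, map_smul,
      real_inner_self_eq_norm_sq, real_inner_comm e x, smul_eq_mul, nsmul_eq_mul]
    push_cast
    ring
  have hin' : Continuous fun x : EuclideanSpace ℝ (Fin n) => inner ℝ e x := hin.continuous
  have i2 : Integrable fun x => h x * (inner ℝ e x * (2 * n * m (‖x‖ ^ 2)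
      - 2 * (1 - ‖x‖ ^ 2) * m₁ (‖x‖ ^ 2))) :=
    integrable_of_continuousOn_ball hb (hh.contDiffOn_one.continuousOn.mul (by fun_prop))
      fun x hx => by simp [hz _ hx, hz₁ _ hx]
  have i1 : Integrable fun x =>
      fderiv ℝ h x ((1 + ‖x‖ ^ 2) • e - (2 * inner ℝ e x) • x) * m (‖x‖ ^ 2) :=
    integrable_of_continuousOn_ball hb ((hh.contDiffOn_fderiv.continuousOn.clm_apply
      (by fun_prop)).mul (by fun_prop)) fun x hx => by simp [hz _ hx]
  have := h3.2
  rw [integral_sub i1 i2] at this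
  linarith

/-- The derivative of a hyperbolic harmonic function at the origin as a weighted integral of the
function. -/
theorem IsHyperbolicHarmonic.integral_mul_dipole (hh : IsHyperbolicHarmonic h) (hn1 : 1 ≤ n)
    (hb : b < 1) (hb0 : 0 ≤ b) (hm : ∀ s, HasDerivAt m (m₁ s) s)
    (hm₁ : ∀ s, HasDerivAt m₁ (m₂ s) s) (hm₂ : Continuous m₂)
    (hz : ∀ s, b < s → m s = 0) (e : EuclideanSpace ℝ (Fin n)) :
    ∫ x, h x * (inner ℝ e x * (2 * n * m (‖x‖ ^ 2) - 2 * (1 - ‖x‖ ^ 2) * m₁ (‖x‖ ^ 2))) =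
      fderiv ℝ h 0 e * ∫ x : EuclideanSpace ℝ (Fin n), m (‖x‖ ^ 2) := by
  obtain ⟨k, rfl⟩ : ∃ k, n = k + 1 := ⟨n - 1, by omega⟩
  obtain ⟨β, -, hβ1, hβ⟩ := exists_between_dilation hb hb0
  have hm₁c := (contDiff_one_of_hasDerivAt hm₁ hm₂).continuous
  have hmc := (contDiff_one_of_hasDerivAt hm hm₁c).continuous
  have hz₁ := hasDerivAt_eq_zero_of_vanishing hm hz
  have hz₂ := hasDerivAt_eq_zero_of_vanishing hm₁ hz₁
  have hcont := hh.contDiffOn_one.continuousOn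
  have hin : Continuous fun x : EuclideanSpace ℝ (Fin (k + 1)) => inner ℝ e x :=
    (innerSL ℝ e).continuous
  set X : EuclideanSpace ℝ (Fin (k + 1)) → ℝ := fun x =>
    fderiv ℝ h x ((1 + ‖x‖ ^ 2) • e - (2 * inner ℝ e x) • x) with hX
  have hXc : ContinuousOn X (ball 0 1) :=
    hh.contDiffOn_fderiv.continuousOn.clm_apply (by fun_prop)
  have hconst : ∀ μ : ℝ, 1 ≤ μ → ∫ x, X x * (μ ^ (k + 1) * m (μ ^ 2 * ‖x‖ ^ 2)) =
      ∫ x, h x * (inner ℝ e x * (2 * (k + 1 : ℕ) * m (‖x‖ ^ 2)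
        - 2 * (1 - ‖x‖ ^ 2) * m₁ (‖x‖ ^ 2))) := by
    intro μ hμ
    have h1 := hh.integral_translation_mul_radial (b := β) hβ1
      (hasDerivAt_scaled hm (μ ^ (k + 1)) (μ ^ 2)) (by fun_prop)
      (fun s hs => by simp [hz _ (hβ μ _ (by linarith) hs)]) e
    refine h1.trans ?_
    -- The kernel is the dipole weight of the dilated profile. Its `μ`-derivative is the kernel of
    -- `integratesToZero_dipole` with `q(s) = μ^k m(μ² s)`, since `∂ₛ(n q + 2 s q') = (n + 2) q' + 2
    -- s q''`.
    have := integral_mul_kernel_eq (h := h) (β := β)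
      (N := fun μ x => inner ℝ e x * (2 * (k + 1 : ℕ) * (μ ^ (k + 1) * m (μ ^ 2 * ‖x‖ ^ 2))
        - 2 * (1 - ‖x‖ ^ 2) * (μ ^ (k + 2 + 1) * m₁ (μ ^ 2 * ‖x‖ ^ 2))))
      (K := fun μ x => inner ℝ e x * (2 * (k + 1 : ℕ) * ((k + 1) * μ ^ k * m (μ ^ 2 * ‖x‖ ^ 2)
          + 2 * ‖x‖ ^ 2 * μ ^ (k + 2) * m₁ (μ ^ 2 * ‖x‖ ^ 2))
        - 2 * (1 - ‖x‖ ^ 2) * (((k + 2 : ℕ) + 1) * μ ^ (k + 2) * m₁ (μ ^ 2 * ‖x‖ ^ 2)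
          + 2 * ‖x‖ ^ 2 * μ ^ (k + 2 + 2) * m₂ (μ ^ 2 * ‖x‖ ^ 2)))) hcont hβ1
      (fun μ x => (((hasDerivAt_dilated_kernel hm k _ μ).const_mul _).sub
        ((hasDerivAt_dilated_kernel hm₁ (k + 2) _ μ).const_mul _)).const_mul _)
      (fun μ => by fun_prop) (by fun_prop)
      (fun μ hμ x hx => by simp [hz _ (hβ μ _ hμ hx), hz₁ _ (hβ μ _ hμ hx)])
      (fun μ hμ x hx => by
        simp [hz _ (hβ μ _ hμ hx), hz₁ _ (hβ μ _ hμ hx), hz₂ _ (hβ μ _ hμ hx)]) ?_ hμ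
    · simp only [one_pow, one_mul] at this
      rw [← this]
      refine integral_congr_ae (.of_forall fun x => ?_)
      ring
    · intro ν hν
      refine (hh.integratesToZero_dipole hβ1 (hasDerivAt_scaled hm (ν ^ k) (ν ^ 2))
        (hasDerivAt_scaled hm₁ (ν ^ k * ν ^ 2) (ν ^ 2))
        (by fun_prop) (fun s hs => by simp [hz _ (hβ ν _ (by linarith) hs)]) e).congr fun x => ?_
      push_cast
      ring
  have hlim := tendsto_integral_mul_dilated_kernel hXc hb hmc hz
  have hX0 : X 0 = fderiv ℝ h 0 e := by simp [hX]
  rw [hX0] at hlim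
  refine tendsto_nhds_unique (tendsto_const_nhds.congr' ?_) hlim
  filter_upwards [eventually_ge_atTop 1] with μ hμ using (hconst μ hμ).symm

end Kernels

/-! ### The mean of `|⟪e, x⟫ - t|` under a radial weight. -/

section Profile

theorem hasDerivAt_max_zero_sq (u : ℝ) :
    HasDerivAt (fun u : ℝ => (max u 0) ^ 2) (2 * max u 0) u := by
  rcases lt_trichotomy u 0 with hu | rfl | hu
  · rw [max_eq_right hu.le, mul_zero]
    refine (hasDerivAt_const u (0 : ℝ)).congr_of_eventuallyEq ?_
    filter_upwards [gt_mem_nhds hu] with v hv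
    simp [max_eq_right (le_of_lt hv)]
  · rw [hasDerivAt_iff_tendsto_slope_zero]
    have h0 : Tendsto (fun t : ℝ => max t 0) (𝓝[≠] 0) (𝓝 (2 * max 0 0)) := by
      have : Continuous fun t : ℝ => max t 0 := by fun_prop
      simpa using (this.tendsto 0).mono_left nhdsWithin_le_nhds
    refine h0.congr' ?_
    filter_upwards [self_mem_nhdsWithin] with t ht
    have ht' : t ≠ 0 := ht
    rcases le_total t 0 with h | h
    · simp [max_eq_right h]
    · simp [max_eq_left h]
      field_simp
  · rw [max_eq_left hu.le]
    have : HasDerivAt (fun v : ℝ => v ^ 2) (2 * u) u := by simpa using hasDerivAt_pow 2 u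
    refine this.congr_of_eventuallyEq ?_
    filter_upwards [lt_mem_nhds hu] with v hv
    rw [max_eq_left hv.le]

/-- The odd antiderivative of `max |u| τ - (1 + τ²) / 2`. -/
noncomputable def profileIntegral (τ u : ℝ) : ℝ :=
  (τ - (1 + τ ^ 2) / 2) * u + (max (u - τ) 0) ^ 2 / 2 - (max (-u - τ) 0) ^ 2 / 2

variable {τ u : ℝ}

theorem hasDerivAt_profileIntegral (hτ : 0 ≤ τ) (u : ℝ) :
    HasDerivAt (profileIntegral τ) (max |u| τ - (1 + τ ^ 2) / 2) u := by
  have h1 := ((hasDerivAt_max_zero_sq (u - τ)).comp u ((hasDerivAt_id u).sub_const τ)).div_const 2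
  have h2 := ((hasDerivAt_max_zero_sq (-u - τ)).comp u
    ((hasDerivAt_id u).neg.sub_const τ)).div_const 2
  have h3 := ((hasDerivAt_id u).const_mul (τ - (1 + τ ^ 2) / 2)).add h1 |>.sub h2
  refine h3.congr_deriv ?_
  rcases le_total 0 u with hu | hu
  · rw [abs_of_nonneg hu, max_eq_right (show -u - τ ≤ 0 by linarith)]
    rcases le_total u τ with h | h
    · rw [max_eq_right h, max_eq_right (by linarith)]; ring
    · rw [max_eq_left h, max_eq_left (by linarith)]; ring
  · rw [abs_of_nonpos hu, max_eq_right (show u - τ ≤ 0 by linarith)]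
    rcases le_total (-u) τ with h | h
    · rw [max_eq_right h, max_eq_right (by linarith)]; ring
    · rw [max_eq_left h, max_eq_left (by linarith)]; ring

theorem profileIntegral_neg : profileIntegral τ (-u) = -profileIntegral τ u := by
  simp only [profileIntegral, neg_neg]; ring

/-- For `0 ≤ u` the profile is `-(1 - τ)² u / 2` up to `τ` and `-(1 - u)(u - τ²) / 2` beyond. The
second expression becomes `-(1 - τ)² (1 + u²) / 2` and `-(1 - u)² (1 + τ²) / 2` respectively. For
`G` equal to the profile over `1 - u²`, the two claims say `u G ≤ 0` and `G' ≤ 0`. -/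
theorem profileIntegral_signs (hτ : 0 ≤ τ) (hτ1 : τ < 1) (hu : |u| < 1) :
    u * profileIntegral τ u ≤ 0 ∧
      (max |u| τ - (1 + τ ^ 2) / 2) * (1 - u ^ 2) + 2 * u * profileIntegral τ u ≤ 0 := by
  wlog h0 : 0 ≤ u generalizing u
  · have := this (u := -u) (by simpa using hu) (by linarith)
    simpa [profileIntegral_neg] using this
  rw [abs_of_nonneg h0] at hu ⊢
  rw [profileIntegral, max_eq_right (show -u - τ ≤ 0 by linarith)]
  rcases le_total u τ with h | h
  · rw [max_eq_right h, max_eq_right (show u - τ ≤ 0 by linarith)]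
    constructor
    · nlinarith [mul_nonneg (sq_nonneg (1 - τ)) (sq_nonneg u)]
    · nlinarith [mul_nonneg (sq_nonneg (1 - τ)) (sq_nonneg u), sq_nonneg (1 - τ)]
  · rw [max_eq_left h, max_eq_left (show 0 ≤ u - τ by linarith)]
    have h2 : 0 ≤ u - τ ^ 2 := by nlinarith
    constructor
    · have : 0 ≤ u * ((1 - u) * (u - τ ^ 2)) := by
        have : 0 ≤ 1 - u := by linarith
        positivity
      linarith
    · have : 0 ≤ (1 - u) ^ 2 * (1 + τ ^ 2) := by positivity
      linarith

variable {n : ℕ} {b : ℝ} {w w₁ : ℝ → ℝ} {e : EuclideanSpace ℝ (Fin n)}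

theorem abs_inner_lt_one (he : ‖e‖ = 1) {x : EuclideanSpace ℝ (Fin n)} (hx : ‖x‖ < 1) :
    |inner ℝ e x| < 1 :=
  (abs_real_inner_le_norm e x).trans_lt (by simpa [he] using hx)

/-- In dimension at least three, the average of `max |⟪e, x⟫| τ` for a rotation invariant weight
on the unit ball is at most the average of `max |u| τ` on `[-1, 1]`. -/
theorem integral_max_inner_mul_le (hn3 : 3 ≤ n) (hb : b < 1)
    (hw : ∀ s, HasDerivAt w (w₁ s) s) (hw₁ : Continuous w₁) (hz : ∀ s, b < s → w s = 0)
    (hw0 : ∀ s, 0 ≤ w s) (he : ‖e‖ = 1) (hτ : 0 ≤ τ) (hτ1 : τ < 1) :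
    ∫ x : EuclideanSpace ℝ (Fin n), max |inner ℝ e x| τ * w (‖x‖ ^ 2) ≤
      (1 + τ ^ 2) / 2 * ∫ x : EuclideanSpace ℝ (Fin n), w (‖x‖ ^ 2) := by
  set A : ℝ → ℝ := fun u => max |u| τ - (1 + τ ^ 2) / 2 with hA
  -- `G` solves `(1 - u²) G' - 2 u G = A`, the equation of zonal fields on the sphere of `ℝ³`.
  set G : ℝ → ℝ := fun u => profileIntegral τ u * (1 - u ^ 2)⁻¹ with hG
  have hAc : Continuous A := by fun_prop
  have hI := contDiff_one_of_hasDerivAt (hasDerivAt_profileIntegral hτ) hAc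
  have hn := contDiff_norm_sq ℝ (E := EuclideanSpace ℝ (Fin n)) (n := 1)
  have hin : ContDiff ℝ 1 fun x : EuclideanSpace ℝ (Fin n) => inner ℝ e x :=
    (innerSL ℝ e).contDiff
  have hwc := contDiff_one_of_hasDerivAt hw hw₁
  have hwcc := hwc.continuous
  have hincc := hin.continuous
  have hGc : ContDiffOn ℝ 1 (fun x : EuclideanSpace ℝ (Fin n) => G (inner ℝ e x)) (ball 0 1) := by
    refine (hI.comp hin).contDiffOn.mul (ContDiffOn.inv
      (contDiff_const.sub (hin.pow 2)).contDiffOn fun x hx => ?_)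
    have := abs_inner_lt_one he (x := x) (by simpa using hx)
    have := (sq_lt_one_iff_abs_lt_one _).2 this
    linarith
  have z1 : ∀ x : EuclideanSpace ℝ (Fin n), b < ‖x‖ ^ 2 →
      w (‖x‖ ^ 2) * (‖x‖ ^ 2 * G (inner ℝ e x)) = 0 := fun x hx => by simp [hz _ hx]
  have z2 : ∀ x : EuclideanSpace ℝ (Fin n), b < ‖x‖ ^ 2 →
      w (‖x‖ ^ 2) * (inner ℝ e x * G (inner ℝ e x)) = 0 := fun x hx => by simp [hz _ hx]
  have h1 := integratesToZero_fderiv_apply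
    (f := fun x : EuclideanSpace ℝ (Fin n) => w (‖x‖ ^ 2) * (‖x‖ ^ 2 * G (inner ℝ e x))) hb
    ((hwc.comp hn).contDiffOn.mul (hn.contDiffOn.mul hGc)) z1 e
  have h2 := integratesToZero_fderiv_apply_self_add
    (f := fun x : EuclideanSpace ℝ (Fin n) => w (‖x‖ ^ 2) * (inner ℝ e x * G (inner ℝ e x))) hb
    ((hwc.comp hn).contDiffOn.mul (hin.contDiffOn.mul hGc)) z2
  -- This is the divergence of `w G (|x|² e - ⟪e, x⟫ x)`. The field is tangent to the spheres about
  -- `0`, so no derivative of `w` survives.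
  have h12 := h1.sub h2
  have hle : ∀ x : EuclideanSpace ℝ (Fin n), A (inner ℝ e x) * w (‖x‖ ^ 2) ≤
      fderiv ℝ (fun x : EuclideanSpace ℝ (Fin n) => w (‖x‖ ^ 2) * (‖x‖ ^ 2 * G (inner ℝ e x))) x e
      - (fderiv ℝ (fun x : EuclideanSpace ℝ (Fin n) =>
          w (‖x‖ ^ 2) * (inner ℝ e x * G (inner ℝ e x))) x x
        + n * (w (‖x‖ ^ 2) * (inner ℝ e x * G (inner ℝ e x)))) := by
    intro x
    rcases lt_or_ge b (‖x‖ ^ 2) with hx | hx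
    · rw [fderiv_eq_zero_of_vanishing z1 x hx, fderiv_eq_zero_of_vanishing z2 x hx]
      simp [hz _ hx]
    have hu := abs_inner_lt_one he (norm_lt_one_of_sq_le hb hx)
    have hu2 := (sq_lt_one_iff_abs_lt_one _).2 hu
    obtain ⟨hs1, hs2⟩ := profileIntegral_signs hτ hτ1 hu
    have dw := hasFDerivAt_radial (hw (‖x‖ ^ 2))
    have dn := hasFDerivAt_norm_sq' x
    have di := hasFDerivAt_inner_left e x
    set u : ℝ := inner ℝ e x with hudef
    have hρ : 0 < 1 - u ^ 2 := by linarith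
    set G' : ℝ := (A u * (1 - u ^ 2) + 2 * u * profileIntegral τ u) / (1 - u ^ 2) ^ 2 with hG'
    have dG : HasDerivAt G G' u := by
      refine ((hasDerivAt_profileIntegral hτ u).fun_mul
        (((hasDerivAt_pow 2 u).const_sub 1).fun_inv hρ.ne')).congr_deriv ?_
      simp only [hG', hA]
      field_simp
      ring
    have dGx : HasFDerivAt (fun x : EuclideanSpace ℝ (Fin n) => G (inner ℝ e x))
        (G' • innerSL ℝ e) x :=
      HasDerivAt.comp_hasFDerivAt (h₂ := G) x dG di
    rw [(dw.fun_mul (dn.fun_mul dGx)).fderiv, (dw.fun_mul (di.fun_mul dGx)).fderiv]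
    simp only [add_apply, smul_apply, innerSL_apply_apply,
      real_inner_self_eq_norm_sq, real_inner_comm e x, smul_eq_mul, nsmul_eq_mul, he, ← hudef]
    have hG'0 : G' ≤ 0 := div_nonpos_of_nonpos_of_nonneg hs2 (by positivity)
    have huG : u * G u ≤ 0 := by
      simp only [hG, ← mul_assoc]
      exact mul_nonpos_of_nonpos_of_nonneg hs1 (inv_nonneg.2 hρ.le)
    have hid : (1 - u ^ 2) * G' - 2 * (u * G u) = A u := by
      simp only [hG', hG]
      field_simp
      ring
    have hn' : (3 : ℝ) ≤ n := by exact_mod_cast hn3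
    have hs : ‖x‖ ^ 2 < 1 := lt_of_le_of_lt hx hb
    -- Equality would hold for `|x| = 1` and `n = 3`. Passing to `|x| < 1` uses `G' ≤ 0`, and
    -- passing to `n ≥ 3` uses `u G ≤ 0`.
    have hmain : A u ≤ (‖x‖ ^ 2 - u ^ 2) * G' - (n - 1) * (u * G u) := by
      have e1 : 0 ≤ (1 - ‖x‖ ^ 2) * (-G') := mul_nonneg (by linarith) (by linarith)
      have e2 : 0 ≤ ((n : ℝ) - 3) * (-(u * G u)) := mul_nonneg (by linarith) (by linarith)
      linarith
    have := mul_le_mul_of_nonneg_right hmain (hw0 (‖x‖ ^ 2))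
    refine this.trans (le_of_eq ?_)
    push_cast
    ring
  have iw : Integrable fun x : EuclideanSpace ℝ (Fin n) => w (‖x‖ ^ 2) :=
    integrable_of_continuousOn_ball hb (by fun_prop) fun x hx => hz _ hx
  have iM : Integrable fun x : EuclideanSpace ℝ (Fin n) => max |inner ℝ e x| τ * w (‖x‖ ^ 2) :=
    integrable_of_continuousOn_ball hb (by fun_prop) fun x hx => by simp [hz _ hx]
  have key := integral_mono (f := fun x => A (inner ℝ e x) * w (‖x‖ ^ 2))
    ((iM.sub (iw.const_mul _)).congr (.of_forall fun x => (sub_mul _ _ _).symm)) h12.1 hle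
  rw [h12.2] at key
  simp only [hA, sub_mul] at key
  rw [integral_sub iM (iw.const_mul _), integral_const_mul] at key
  linarith

theorem max_abs_abs_eq (a c : ℝ) : max |a| |c| = (|a - c| + |a + c|) / 2 := by
  rcases abs_cases a with h1 | h1 <;> rcases abs_cases c with h2 | h2 <;>
    rcases abs_cases (a - c) with h3 | h3 <;> rcases abs_cases (a + c) with h4 | h4 <;>
    rcases max_cases |a| |c| with h5 | h5 <;> linarith

/-- The symmetry `x ↦ -x` allows `|u - t|` to be averaged with `|u + t|`, and that average is `max
|u| |t|`. -/
theorem integral_abs_inner_sub_mul_le (hn3 : 3 ≤ n) (hb : b < 1)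
    (hw : ∀ s, HasDerivAt w (w₁ s) s) (hw₁ : Continuous w₁) (hz : ∀ s, b < s → w s = 0)
    (hw0 : ∀ s, 0 ≤ w s) (he : ‖e‖ = 1) {t : ℝ} (ht : |t| < 1) :
    ∫ x : EuclideanSpace ℝ (Fin n), |inner ℝ e x - t| * w (‖x‖ ^ 2) ≤
      (1 + t ^ 2) / 2 * ∫ x : EuclideanSpace ℝ (Fin n), w (‖x‖ ^ 2) := by
  have hwcc := (contDiff_one_of_hasDerivAt hw hw₁).continuous
  have hincc : Continuous fun x : EuclideanSpace ℝ (Fin n) => inner ℝ e x :=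
    (innerSL ℝ e).continuous
  have hmax := integral_max_inner_mul_le hn3 hb hw hw₁ hz hw0 he (abs_nonneg t) ht
  rw [sq_abs] at hmax
  have i1 : Integrable fun x : EuclideanSpace ℝ (Fin n) => |inner ℝ e x - t| * w (‖x‖ ^ 2) :=
    integrable_of_continuousOn_ball hb (by fun_prop) fun x hx => by simp [hz _ hx]
  have i2 : Integrable fun x : EuclideanSpace ℝ (Fin n) => |inner ℝ e x + t| * w (‖x‖ ^ 2) :=
    integrable_of_continuousOn_ball hb (by fun_prop) fun x hx => by simp [hz _ hx]
  have hflip : ∫ x : EuclideanSpace ℝ (Fin n), |inner ℝ e x + t| * w (‖x‖ ^ 2) =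
      ∫ x : EuclideanSpace ℝ (Fin n), |inner ℝ e x - t| * w (‖x‖ ^ 2) := by
    rw [← integral_neg_eq_self]
    refine integral_congr_ae (.of_forall fun x => ?_)
    simp only [inner_neg_right, norm_neg]
    rw [← abs_neg, neg_add, neg_neg, sub_eq_add_neg]
  have hsum : ∫ x : EuclideanSpace ℝ (Fin n), max |inner ℝ e x| |t| * w (‖x‖ ^ 2) =
      ((∫ x : EuclideanSpace ℝ (Fin n), |inner ℝ e x - t| * w (‖x‖ ^ 2)) +
        ∫ x : EuclideanSpace ℝ (Fin n), |inner ℝ e x + t| * w (‖x‖ ^ 2)) / 2 := by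
    rw [← integral_add i1 i2, ← integral_div]
    refine integral_congr_ae (.of_forall fun x => ?_)
    simp only [max_abs_abs_eq]
    ring
  linarith

end Profile

/-! ### The gradient estimate at the origin. -/

section Origin

variable {n : ℕ} {h : EuclideanSpace ℝ (Fin n) → ℝ} {a b : ℝ}

/-- Radial weights whose associated dipole weight `2 n m - 2 (1 - s) m'` is nonnegative and
concentrated near the unit sphere. -/
theorem exists_radial_weight (n : ℕ) (ha : 0 < a) (ha1 : a < 1) :
    ∃ m m₁ m₂ : ℝ → ℝ, ∃ b, b < 1 ∧ 0 ≤ b ∧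
    (∀ s, HasDerivAt m (m₁ s) s) ∧ (∀ s, HasDerivAt m₁ (m₂ s) s) ∧ Continuous m₂ ∧
    (∀ s, b < s → m s = 0) ∧ (∀ s, 0 ≤ m s) ∧ m 0 ≠ 0 ∧
    (∀ s, 0 ≤ 2 * n * m s - 2 * (1 - s) * m₁ s) ∧
    ∀ s, s < a → 2 * n * m s - 2 * (1 - s) * m₁ s = 0 := by
  set b : ℝ := (1 + a) / 2 with hb
  have hab : a < b := by rw [hb]; linarith
  have hb1 : b < 1 := by rw [hb]; linarith
  set χ : ℝ → ℝ := fun s => Real.smoothTransition ((b - s) / (b - a)) with hχ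
  have hχc : ContDiff ℝ 2 χ := by
    have : ContDiff ℝ 2 fun s : ℝ => (b - s) / (b - a) := by fun_prop
    exact (Real.smoothTransition.contDiff (n := 2)).comp this
  have hχz : ∀ s, b < s → χ s = 0 := fun s hs =>
    Real.smoothTransition.zero_of_nonpos (div_nonpos_of_nonpos_of_nonneg (by linarith)
      (by linarith))
  have hχ1 : ∀ s, s < a → χ s = 1 := fun s hs =>
    Real.smoothTransition.one_of_one_le ((one_le_div (by linarith)).2 (by linarith))
  have hχanti : Antitone χ := fun s s' hs => Real.smoothTransition.monotone
    (div_le_div_of_nonneg_right (by linarith) (by linarith))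
  have hχd : ∀ s, HasDerivAt χ (deriv χ s) s :=
    fun s => (hχc.differentiable two_ne_zero s).hasDerivAt
  -- Up to a constant, `(1 - s)^(-n)` is the hyperbolic volume density, which hyperbolic
  -- translations preserve. Its contribution to the dipole weight is therefore zero, and only `-2 (1
  -- - s)^(1-n) χ'` remains: nonnegative as `χ` decreases, and zero where `χ` is constant.
  set m : ℝ → ℝ := fun s => χ s * ((1 - s) ^ n)⁻¹ with hm
  have hmz : ∀ s, b < s → m s = 0 := fun s hs => by simp [hm, hχz s hs]
  have hmc : ContDiff ℝ 2 m := by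
    rw [contDiff_iff_contDiffAt]
    intro s
    rcases lt_or_ge b s with hs | hs
    · exact contDiffAt_const.congr_of_eventuallyEq
        ((lt_mem_nhds hs).mono fun y hy => hmz y hy)
    · refine hχc.contDiffAt.mul (ContDiffAt.inv (by fun_prop) (pow_ne_zero _ ?_))
      linarith
  have hm1 : ContDiff ℝ 1 (deriv m) := by
    have : ContDiff ℝ (1 + 1) m := by simpa [one_add_one_eq_two] using hmc
    exact (contDiff_succ_iff_deriv.1 this).2.2
  have hmd : ∀ s, HasDerivAt m (deriv m s) s :=
    fun s => (hmc.differentiable two_ne_zero s).hasDerivAt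
  have hw : ∀ s, s < 1 → 2 * n * m s - 2 * (1 - s) * deriv m s =
      2 * (1 - s) * (-deriv χ s) * ((1 - s) ^ n)⁻¹ := by
    intro s hs
    have h0 : 1 - s ≠ 0 := by linarith
    have := (hχd s).fun_mul ((((hasDerivAt_id s).const_sub 1).fun_pow n).fun_inv
      (pow_ne_zero _ h0))
    rw [show deriv m s = _ from this.deriv, hm]
    rcases n with _ | k
    · simp
    · simp
      field_simp
      ring
  have hwz : ∀ s, b < s → 2 * n * m s - 2 * (1 - s) * deriv m s = 0 := fun s hs => by
    rw [hmz s hs, hasDerivAt_eq_zero_of_vanishing hmd hmz s hs]; simp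
  refine ⟨m, deriv m, deriv (deriv m), b, hb1, by linarith, hmd,
    fun s => (hm1.differentiable one_ne_zero s).hasDerivAt,
    hm1.continuous_deriv le_rfl, hmz, fun s => ?_, ?_, fun s => ?_, fun s hs => ?_⟩
  · rcases lt_or_ge b s with hs | hs
    · exact (hmz s hs).ge
    · have : 0 < 1 - s := by linarith
      exact mul_nonneg (Real.smoothTransition.nonneg _) (by positivity)
  · simp [hm, hχ1 0 ha]
  · rcases lt_or_ge b s with hs | hs
    · exact (hwz s hs).ge
    · have : 0 < 1 - s := by linarith
      have : 0 ≤ -deriv χ s := neg_nonneg.2 hχanti.deriv_nonpos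
      rw [hw s (by linarith)]
      positivity
  · have : χ =ᶠ[𝓝 s] fun _ => 1 := (gt_mem_nhds hs).mono fun y hy => hχ1 y hy
    rw [hw s (by linarith), this.deriv_eq]
    simp

theorem IsHyperbolicHarmonic.mul_fderiv_zero_le (hh : IsHyperbolicHarmonic h) (hn3 : 3 ≤ n)
    (hmaps : ∀ x ∈ unitBall n, h x ∈ Ioo (-1 : ℝ) 1) {e : EuclideanSpace ℝ (Fin n)}
    (he : ‖e‖ = 1) (ha : 0 < a) (ha1 : a < 1) :
    fderiv ℝ h 0 e * a ≤ (n - 1) * (1 - h 0 ^ 2) := by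
  obtain ⟨m, m₁, m₂, b, hb, hb0, hm, hm₁, hm₂, hz, hm0, hm00, hw0, hwa⟩ :=
    exists_radial_weight n ha ha1
  have hz₁ := hasDerivAt_eq_zero_of_vanishing hm hz
  have hm₁c := contDiff_one_of_hasDerivAt hm₁ hm₂
  have hmc := contDiff_one_of_hasDerivAt hm hm₁c.continuous
  have hmcc := hmc.continuous
  have hm₁cc := hm₁c.continuous
  set w : ℝ → ℝ := fun s => 2 * n * m s - 2 * (1 - s) * m₁ s with hwdef
  have hw : ∀ s, HasDerivAt w (2 * n * m₁ s - (-2 * m₁ s + 2 * (1 - s) * m₂ s)) s := fun s => by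
    refine (((hm s).const_mul (2 * (n : ℝ))).fun_sub
      ((((hasDerivAt_id s).const_sub 1).const_mul 2).fun_mul (hm₁ s))).congr_deriv ?_
    simp
  have hwz : ∀ s, b < s → w s = 0 := fun s hs => by simp [hwdef, hz s hs, hz₁ s hs]
  have hw₁ : Continuous fun s => 2 * n * m₁ s - (-2 * m₁ s + 2 * (1 - s) * m₂ s) := by fun_prop
  have hwcc : Continuous w := (contDiff_one_of_hasDerivAt hw hw₁).continuous
  have hincc : Continuous fun x : EuclideanSpace ℝ (Fin n) => inner ℝ e x :=
    (innerSL ℝ e).continuous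
  have hcont := hh.contDiffOn_one.continuousOn
  have hmem0 : (0 : EuclideanSpace ℝ (Fin n)) ∈ unitBall n := by simp [unitBall]
  have h0 := hmaps 0 hmem0
  have ht : |-h 0| < 1 := by rw [abs_neg, abs_lt]; exact h0
  set C : ℝ := ∫ x : EuclideanSpace ℝ (Fin n), m (‖x‖ ^ 2) with hC
  set W : ℝ := ∫ x : EuclideanSpace ℝ (Fin n), w (‖x‖ ^ 2) with hW
  have iw : Integrable fun x : EuclideanSpace ℝ (Fin n) => w (‖x‖ ^ 2) :=
    integrable_of_continuousOn_ball hb (by fun_prop) fun x hx => hwz _ hx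
  have isw : Integrable fun x : EuclideanSpace ℝ (Fin n) => ‖x‖ ^ 2 * w (‖x‖ ^ 2) :=
    integrable_of_continuousOn_ball hb (by fun_prop) fun x hx => by simp [hwz _ hx]
  have im : Integrable fun x : EuclideanSpace ℝ (Fin n) => m (‖x‖ ^ 2) :=
    integrable_of_continuousOn_ball hb (by fun_prop) fun x hx => hz _ hx
  have hCpos : 0 < C :=
    Continuous.integral_pos_of_hasCompactSupport_nonneg_nonzero (by fun_prop)
      (hasCompactSupport_of_vanishing hb fun x hx => hz _ hx) (fun x => hm0 _) (x := 0)
      (by simpa using hm00)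
  have hdip : ∫ x, h x * (inner ℝ e x * w (‖x‖ ^ 2)) = fderiv ℝ h 0 e * C :=
    hh.integral_mul_dipole (by omega) hb hb0 hm hm₁ hm₂ hz e
  have hmean : ∫ x, h x * w (‖x‖ ^ 2) = h 0 * W :=
    hh.integral_mul_radial (by omega) hb hb0 hw hw₁ hwz
  have hupper : fderiv ℝ h 0 e * C ≤ (1 - h 0 ^ 2) / 2 * W := by
    have i1 : Integrable fun x => h x * (inner ℝ e x * w (‖x‖ ^ 2)) :=
      integrable_of_continuousOn_ball hb (hcont.mul (by fun_prop)) fun x hx => by simp [hwz _ hx]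
    have i2 : Integrable fun x => h x * w (‖x‖ ^ 2) :=
      integrable_of_continuousOn_ball hb (hcont.mul (by fun_prop)) fun x hx => by simp [hwz _ hx]
    have i3 : Integrable fun x : EuclideanSpace ℝ (Fin n) =>
        |inner ℝ e x - -h 0| * w (‖x‖ ^ 2) :=
      integrable_of_continuousOn_ball hb (by fun_prop) fun x hx => by simp [hwz _ hx]
    -- Integrates `h (⟪e, x⟫ + h(0)) w ≤ |⟪e, x⟫ + h(0)| w`. The shift `h(0)` is the choice `t =
    -- -h(0)` in the mean estimate.
    have hle := integral_mono (i1.add (i2.const_mul (h 0))) i3 fun x => ?_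
    · have hadd : ∫ x, ((fun x => h x * (inner ℝ e x * w (‖x‖ ^ 2))) +
          fun x => h 0 * (h x * w (‖x‖ ^ 2))) x = fderiv ℝ h 0 e * C + h 0 * (h 0 * W) := by
        rw [integral_add' i1 (i2.const_mul _), integral_const_mul, hdip, hmean]
      rw [hadd] at hle
      have := integral_abs_inner_sub_mul_le hn3 hb hw hw₁ hwz hw0 he ht
      rw [← hW] at this
      nlinarith
    · rcases lt_or_ge b (‖x‖ ^ 2) with hx | hx
      · simp [hwz _ hx]
      have hx1 := hmaps x (by simpa [unitBall] using norm_lt_one_of_sq_le hb hx)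
      have : h x * (inner ℝ e x - -h 0) ≤ |inner ℝ e x - -h 0| := by
        refine (le_abs_self _).trans ?_
        rw [abs_mul]
        exact mul_le_of_le_one_left (abs_nonneg _) (abs_le.2 ⟨hx1.1.le, hx1.2.le⟩)
      have := mul_le_mul_of_nonneg_right this (hw0 (‖x‖ ^ 2))
      simp only [Pi.add_apply]
      refine le_trans (le_of_eq ?_) this
      simp only [hwdef]
      ring
  -- The divergence of `ρ m x` gives `∫ |x|² w = ∫ (n + (n - 2)|x|²) m ≤ (2n - 2) C`, and `w` lives
  -- on `|x|² ≥ a`.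
  have hlower : a * W ≤ (2 * n - 2) * C := by
    have hdiv := integratesToZero_fderiv_apply_self_add
      (f := fun x : EuclideanSpace ℝ (Fin n) => (1 - ‖x‖ ^ 2) * m (‖x‖ ^ 2)) hb
      ((contDiff_const.sub (contDiff_norm_sq ℝ)).mul
        (hmc.comp (contDiff_norm_sq ℝ))).contDiffOn (fun x hx => by simp [hz _ hx])
    have heq : ∀ x : EuclideanSpace ℝ (Fin n),
        fderiv ℝ (fun x : EuclideanSpace ℝ (Fin n) => (1 - ‖x‖ ^ 2) * m (‖x‖ ^ 2)) x x
          + n * ((1 - ‖x‖ ^ 2) * m (‖x‖ ^ 2)) =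
        (n + (n - 2) * ‖x‖ ^ 2) * m (‖x‖ ^ 2) - ‖x‖ ^ 2 * w (‖x‖ ^ 2) := by
      intro x
      rw [(((hasFDerivAt_norm_sq' x).const_sub 1).fun_mul
        (hasFDerivAt_radial (hm (‖x‖ ^ 2)))).fderiv]
      simp only [add_apply, smul_apply, neg_apply, innerSL_apply_apply,
        real_inner_self_eq_norm_sq, smul_eq_mul, nsmul_eq_mul, hwdef]
      push_cast
      ring
    have hz0 := hdiv.congr heq
    have h1 : a * W ≤ ∫ x : EuclideanSpace ℝ (Fin n), ‖x‖ ^ 2 * w (‖x‖ ^ 2) := by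
      rw [hW, ← integral_const_mul]
      refine integral_mono (iw.const_mul a) isw fun x => ?_
      rcases lt_or_ge (‖x‖ ^ 2) a with hx | hx
      · have : w (‖x‖ ^ 2) = 0 := hwa _ hx
        simp [this]
      · exact mul_le_mul_of_nonneg_right hx (hw0 _)
    have h2 : (∫ x : EuclideanSpace ℝ (Fin n), ‖x‖ ^ 2 * w (‖x‖ ^ 2)) ≤ (2 * n - 2) * C := by
      have hle : ∫ x : EuclideanSpace ℝ (Fin n), (‖x‖ ^ 2 * w (‖x‖ ^ 2)
          + ((n + (n - 2) * ‖x‖ ^ 2) * m (‖x‖ ^ 2) - ‖x‖ ^ 2 * w (‖x‖ ^ 2))) ≤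
          ∫ x : EuclideanSpace ℝ (Fin n), (2 * n - 2) * m (‖x‖ ^ 2) := by
        refine integral_mono (isw.add hz0.1) (im.const_mul _) fun x => ?_
        rcases lt_or_ge b (‖x‖ ^ 2) with hx | hx
        · simp [hz _ hx]
        have hn' : (3 : ℝ) ≤ n := by exact_mod_cast hn3
        have : (n + (n - 2) * ‖x‖ ^ 2 : ℝ) ≤ 2 * n - 2 := by nlinarith
        have := mul_le_mul_of_nonneg_right this (hm0 (‖x‖ ^ 2))
        simp only
        linarith
      rw [integral_add isw hz0.1, hz0.2, integral_const_mul] at hle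
      linarith
    exact h1.trans h2
  have hsq : 0 ≤ 1 - h 0 ^ 2 := by nlinarith [h0.1, h0.2]
  have : fderiv ℝ h 0 e * a * C ≤ (n - 1) * (1 - h 0 ^ 2) * C := by
    nlinarith [mul_le_mul_of_nonneg_left hupper ha.le, mul_le_mul_of_nonneg_left hlower hsq]
  exact le_of_mul_le_mul_right this hCpos

theorem IsHyperbolicHarmonic.fderiv_zero_le (hh : IsHyperbolicHarmonic h) (hn3 : 3 ≤ n)
    (hmaps : ∀ x ∈ unitBall n, h x ∈ Ioo (-1 : ℝ) 1) {e : EuclideanSpace ℝ (Fin n)}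
    (he : ‖e‖ = 1) : fderiv ℝ h 0 e ≤ (n - 1) * (1 - h 0 ^ 2) := by
  have hlim : Tendsto (fun a : ℝ => fderiv ℝ h 0 e * a) (𝓝[<] 1) (𝓝 (fderiv ℝ h 0 e * 1)) :=
    ((continuous_const.mul continuous_id).tendsto 1).mono_left nhdsWithin_le_nhds
  rw [mul_one] at hlim
  refine le_of_tendsto hlim ?_
  filter_upwards [Ioo_mem_nhdsLT (zero_lt_one' ℝ)] with a ha
  exact hh.mul_fderiv_zero_le hn3 hmaps he ha.1 ha.2

end Origin

/-! ### Invariance under inversions preserving the ball. -/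

section Inversion

variable {n : ℕ} {h : EuclideanSpace ℝ (Fin n) → ℝ} {c x : EuclideanSpace ℝ (Fin n)}

/-- The inversion in the sphere centred at `c` that is orthogonal to the unit sphere. -/
noncomputable def ballInversion (c : EuclideanSpace ℝ (Fin n)) :
    EuclideanSpace ℝ (Fin n) → EuclideanSpace ℝ (Fin n) :=
  EuclideanGeometry.inversion c √(‖c‖ ^ 2 - 1)

theorem ballInversion_factor (hc : 1 < ‖c‖) (x : EuclideanSpace ℝ (Fin n)) :
    (√(‖c‖ ^ 2 - 1) / dist x c) ^ 2 = (‖c‖ ^ 2 - 1) / ‖x - c‖ ^ 2 := by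
  rw [div_pow, Real.sq_sqrt (by nlinarith), dist_eq_norm]

theorem ballInversion_apply (hc : 1 < ‖c‖) (x : EuclideanSpace ℝ (Fin n)) :
    ballInversion c x = ((‖c‖ ^ 2 - 1) / ‖x - c‖ ^ 2) • (x - c) + c := by
  rw [ballInversion, EuclideanGeometry.inversion, ballInversion_factor hc]
  rfl

theorem ne_center (hc : 1 < ‖c‖) (hx : ‖x‖ < 1) : x ≠ c := by
  rintro rfl
  linarith

theorem norm_sub_center_pos (hc : 1 < ‖c‖) (hx : ‖x‖ < 1) : 0 < ‖x - c‖ ^ 2 := by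
  have := norm_pos_iff.2 (sub_ne_zero.2 (ne_center hc hx))
  positivity

theorem one_sub_norm_sq_ballInversion (hc : 1 < ‖c‖) (hx : ‖x‖ < 1) :
    1 - ‖ballInversion c x‖ ^ 2 = (‖c‖ ^ 2 - 1) / ‖x - c‖ ^ 2 * (1 - ‖x‖ ^ 2) := by
  have hN := norm_sub_center_pos hc hx
  have hx2 : ‖x‖ ^ 2 = ‖x - c‖ ^ 2 + 2 * inner ℝ (x - c) c + ‖c‖ ^ 2 := by
    rw [← norm_add_sq_real, sub_add_cancel]
  rw [ballInversion_apply hc, norm_add_sq_real, norm_smul, inner_smul_left, hx2, mul_pow,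
    Real.norm_eq_abs, sq_abs]
  have hN0 : ‖x - c‖ ≠ 0 := fun h0 => by simp [h0] at hN
  simp
  field_simp
  ring

theorem norm_ballInversion_lt_one (hc : 1 < ‖c‖) (hx : ‖x‖ < 1) : ‖ballInversion c x‖ < 1 := by
  have h1 := one_sub_norm_sq_ballInversion hc hx
  have h2 : 0 < (‖c‖ ^ 2 - 1) / ‖x - c‖ ^ 2 * (1 - ‖x‖ ^ 2) :=
    mul_pos (div_pos (by nlinarith) (norm_sub_center_pos hc hx)) (by nlinarith [norm_nonneg x])
  rw [← h1] at h2
  nlinarith [norm_nonneg (ballInversion c x)]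

theorem contDiffOn_ballInversion {k : ℕ∞} (hc : 1 < ‖c‖) :
    ContDiffOn ℝ k (ballInversion c) (ball 0 1) :=
  contDiffOn_const.inversion contDiffOn_const contDiffOn_id
    fun _ hx => ne_center hc (by simpa using hx)

/-- The derivative of `ballInversion`, written with its conformal factor. -/
theorem hasFDerivAt_ballInversion (hc : 1 < ‖c‖) (hx : ‖x‖ < 1) :
    HasFDerivAt (ballInversion c) (((‖c‖ ^ 2 - 1) / ‖x - c‖ ^ 2) •
      ((ℝ ∙ (x - c))ᗮ.reflection : EuclideanSpace ℝ (Fin n) →L[ℝ] EuclideanSpace ℝ (Fin n))) x := by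
  have := EuclideanGeometry.hasFDerivAt_inversion (R := √(‖c‖ ^ 2 - 1)) (ne_center hc hx)
  rwa [ballInversion_factor hc] at this

theorem reflection_orthogonal_singleton_apply (y v : EuclideanSpace ℝ (Fin n)) :
    (ℝ ∙ y)ᗮ.reflection v = v - (2 * inner ℝ y v / ‖y‖ ^ 2) • y := by
  rw [Submodule.reflection_orthogonal_apply, Submodule.reflection_singleton_apply]
  simp [two_smul, ← add_smul]
  congr 1
  ring

theorem fderiv_comp_ballInversion (hh : IsHyperbolicHarmonic h) (hc : 1 < ‖c‖) (hx : ‖x‖ < 1)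
    (v : EuclideanSpace ℝ (Fin n)) :
    fderiv ℝ (h ∘ ballInversion c) x v = fderiv ℝ h (ballInversion c x)
      (((‖c‖ ^ 2 - 1) / ‖x - c‖ ^ 2) • (ℝ ∙ (x - c))ᗮ.reflection v) := by
  rw [((hh.differentiableAt (norm_ballInversion_lt_one hc hx)).hasFDerivAt.comp x
    (hasFDerivAt_ballInversion hc hx)).fderiv]
  simp

/-- The derivative in the direction `v` of the derivative of `ballInversion` in that direction. -/
theorem hasFDerivAt_fderiv_ballInversion_apply (hc : 1 < ‖c‖) (hx : ‖x‖ < 1)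
    (v : EuclideanSpace ℝ (Fin n)) :
    ∃ D : EuclideanSpace ℝ (Fin n) →L[ℝ] EuclideanSpace ℝ (Fin n),
      HasFDerivAt (fun y => ((‖c‖ ^ 2 - 1) / ‖y - c‖ ^ 2) • (ℝ ∙ (y - c))ᗮ.reflection v) D x ∧
      D v = ((‖c‖ ^ 2 - 1) / (‖x - c‖ ^ 2) ^ 2) • ((-4 * inner ℝ (x - c) v) • v +
        (8 * inner ℝ (x - c) v ^ 2 / ‖x - c‖ ^ 2 - 2 * ‖v‖ ^ 2) • (x - c)) := by
  have hN := norm_sub_center_pos hc hx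
  have dsub : HasFDerivAt (fun y : EuclideanSpace ℝ (Fin n) => y - c)
      (ContinuousLinearMap.id ℝ _) x := (hasFDerivAt_id x).sub_const c
  have dN : HasFDerivAt (fun y : EuclideanSpace ℝ (Fin n) => ‖y - c‖ ^ 2)
      (2 • innerSL ℝ (x - c)) x := by
    have := (hasFDerivAt_norm_sq' (x - c)).comp x dsub
    rw [ContinuousLinearMap.comp_id] at this
    exact this
  have di : HasFDerivAt (fun y : EuclideanSpace ℝ (Fin n) => inner ℝ v (y - c))
      (innerSL ℝ v) x := by
    have := (hasFDerivAt_inner_left v (x - c)).comp x dsub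
    rw [ContinuousLinearMap.comp_id] at this
    exact this
  have dinv : HasFDerivAt (fun y : EuclideanSpace ℝ (Fin n) => (‖y - c‖ ^ 2)⁻¹)
      (-((‖x - c‖ ^ 2) ^ 2)⁻¹ • 2 • innerSL ℝ (x - c)) x :=
    (hasDerivAt_inv hN.ne').comp_hasFDerivAt x dN
  have d1 := dinv.smul_const v
  have d2 := ((dinv.fun_mul dinv).fun_mul (di.const_mul 2)).fun_smul dsub
  have d3 := (d1.fun_sub d2).fun_const_smul (‖c‖ ^ 2 - 1)
  refine ⟨_, d3.congr_of_eventuallyEq (.of_forall fun y => ?_), ?_⟩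
  · simp only [reflection_orthogonal_singleton_apply, smul_sub, smul_smul,
      real_inner_comm v]
    congr 2 <;> ring_nf
  · simp only [smul_apply, sub_apply, add_apply, ContinuousLinearMap.smulRight_apply,
      innerSL_apply_apply, ContinuousLinearMap.id_apply,
      real_inner_comm v (x - c), real_inner_self_eq_norm_sq, smul_eq_mul, nsmul_eq_mul]
    module

/-- The derivative of the inversion is a scalar times a reflection. The reflection maps an
orthonormal basis to another, so the Hessian term yields the Laplacian times the squared scalar. The
rest is the trace of the second derivative of the inversion, in which `-4 + 8 - 2n = -2(n - 2)`. -/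
theorem laplacian_comp_ballInversion (hh : IsHyperbolicHarmonic h) (hc : 1 < ‖c‖)
    (hx : ‖x‖ < 1) :
    Laplacian.laplacian (h ∘ ballInversion c) x =
      ((‖c‖ ^ 2 - 1) / ‖x - c‖ ^ 2) ^ 2 * Laplacian.laplacian h (ballInversion c x)
      - 2 * ((n : ℝ) - 2) * ((‖c‖ ^ 2 - 1) / (‖x - c‖ ^ 2) ^ 2)
        * fderiv ℝ h (ballInversion c x) (x - c) := by
  have hxb : ball (0 : EuclideanSpace ℝ (Fin n)) 1 ∈ 𝓝 x :=
    isOpen_ball.mem_nhds (by simpa using hx)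
  have hz := norm_ballInversion_lt_one hc hx
  have hzb : ball (0 : EuclideanSpace ℝ (Fin n)) 1 ∈ 𝓝 (ballInversion c x) :=
    isOpen_ball.mem_nhds (by simpa using hz)
  set z := ballInversion c x with hzdef
  have hH : ContDiffOn ℝ 2 (h ∘ ballInversion c) (ball 0 1) :=
    hh.1.comp (contDiffOn_ballInversion (k := 2) hc) fun y hy => by
      simpa [unitBall] using norm_ballInversion_lt_one hc (by simpa using hy)
  have dH : HasFDerivAt (fderiv ℝ (h ∘ ballInversion c))
      (fderiv ℝ (fderiv ℝ (h ∘ ballInversion c)) x) x :=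
    (((hH.fderiv_of_isOpen isOpen_ball (m := 1) (by norm_num)).contDiffAt hxb).differentiableAt
      one_ne_zero).hasFDerivAt
  have dDh : HasFDerivAt (fderiv ℝ h) (fderiv ℝ (fderiv ℝ h) z) z :=
    ((hh.contDiffOn_fderiv.contDiffAt hzb).differentiableAt one_ne_zero).hasFDerivAt
  set refl := (ℝ ∙ (x - c))ᗮ.reflection with hrefl
  set lam : ℝ := (‖c‖ ^ 2 - 1) / ‖x - c‖ ^ 2 with hlam
  have hv : ∀ v, fderiv ℝ (fderiv ℝ (h ∘ ballInversion c)) x v v =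
      lam ^ 2 * fderiv ℝ (fderiv ℝ h) z (refl v) (refl v) +
      (‖c‖ ^ 2 - 1) / (‖x - c‖ ^ 2) ^ 2 * (-4 * (inner ℝ (x - c) v * fderiv ℝ h z v) +
        (8 * inner ℝ (x - c) v ^ 2 / ‖x - c‖ ^ 2 - 2 * ‖v‖ ^ 2) * fderiv ℝ h z (x - c)) := by
    intro v
    obtain ⟨D, hD, hDv⟩ := hasFDerivAt_fderiv_ballInversion_apply hc hx v
    have d1 : HasFDerivAt (fun y => fderiv ℝ (h ∘ ballInversion c) y v)
        ((fderiv ℝ (fderiv ℝ (h ∘ ballInversion c)) x).flip v) x := by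
      simpa using dH.clm_apply (hasFDerivAt_const v x)
    have d2 := (dDh.comp x (hasFDerivAt_ballInversion hc hx)).clm_apply hD
    have heq : (fun y => fderiv ℝ (h ∘ ballInversion c) y v) =ᶠ[𝓝 x]
        fun y => (fderiv ℝ h ∘ ballInversion c) y
          (((‖c‖ ^ 2 - 1) / ‖y - c‖ ^ 2) • (ℝ ∙ (y - c))ᗮ.reflection v) := by
      filter_upwards [hxb] with y hy
      exact fderiv_comp_ballInversion hh hc (by simpa using hy) v
    have := d1.unique (d2.congr_of_eventuallyEq heq)
    have := congrArg (fun A : EuclideanSpace ℝ (Fin n) →L[ℝ] ℝ => A v) this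
    simp only [ContinuousLinearMap.flip_apply, add_apply, ContinuousLinearMap.comp_apply, hDv,
      Function.comp_apply, smul_apply, map_smul, map_add, smul_eq_mul, ← hzdef, ← hlam,
      ← hrefl] at this
    rw [this]
    simp
    ring
  have hlap : ∑ i, fderiv ℝ (fderiv ℝ h) z (refl (EuclideanSpace.single i 1))
      (refl (EuclideanSpace.single i 1)) = Laplacian.laplacian h z := by
    rw [laplacian_eq_iteratedFDeriv_orthonormalBasis h
      ((EuclideanSpace.basisFun (Fin n) ℝ).map refl)]
    simp [iteratedFDeriv_two_apply]
  have hsq : ∑ i, inner ℝ (x - c) (EuclideanSpace.single i (1 : ℝ)) ^ 2 = ‖x - c‖ ^ 2 := by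
    have := sum_inner_mul_apply_single (innerSL ℝ (x - c)) (x - c)
    simpa only [innerSL_apply_apply, real_inner_self_eq_norm_sq, ← sq] using this
  have hN := (norm_sub_center_pos hc hx).ne'
  rw [laplacian_eq_sum_fderiv_fderiv]
  simp_rw [hv, Finset.sum_add_distrib, ← Finset.mul_sum, hlap, Finset.sum_add_distrib,
    ← Finset.mul_sum, sum_inner_mul_apply_single, ← Finset.sum_mul, Finset.sum_sub_distrib,
    ← Finset.sum_div, ← Finset.mul_sum, hsq]
  rw [mul_div_assoc, div_self hN]
  simp
  ring

/-- With `λ` the conformal factor at `x` and `T` the inversion, `1 - |T x|² = λ ρ`. Hence the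
equation for `h` at `T x`, multiplied by `λ ρ`, turns into the equation for `h ∘ T` at `x`. -/
theorem IsHyperbolicHarmonic.comp_ballInversion (hh : IsHyperbolicHarmonic h) (hc : 1 < ‖c‖) :
    IsHyperbolicHarmonic (h ∘ ballInversion c) := by
  refine ⟨hh.1.comp (contDiffOn_ballInversion (k := 2) hc) fun x hx => ?_, fun x hx => ?_⟩
  · simpa [unitBall] using norm_ballInversion_lt_one hc (by simpa [unitBall] using hx)
  have hx1 : ‖x‖ < 1 := by simpa [unitBall] using hx
  have hN := norm_sub_center_pos hc hx1
  have hz := hh.laplacian_eq (norm_ballInversion_lt_one hc hx1)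
  rw [one_sub_norm_sq_ballInversion hc hx1] at hz
  rw [hyperbolicLaplacian, sum_coord_mul_apply_single, laplacian_comp_ballInversion hh hc hx1,
    fderiv_comp_ballInversion hh hc hx1, reflection_orthogonal_singleton_apply]
  set L := fderiv ℝ h (ballInversion c x) with hL
  have hLz : L (ballInversion c x) = (‖c‖ ^ 2 - 1) / ‖x - c‖ ^ 2 * L (x - c) + L c := by
    rw [ballInversion_apply hc]; simp
  have hLx : L x = L (x - c) + L c := by simp
  rw [hLz] at hz
  simp only [map_smul, map_sub L x (_ • _), hLx, smul_eq_mul]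
  have e1 : inner ℝ (x - c) x = ‖x‖ ^ 2 - inner ℝ x c := by
    rw [inner_sub_left, real_inner_self_eq_norm_sq, real_inner_comm]
  have e2 : ‖x - c‖ ^ 2 = ‖x‖ ^ 2 - 2 * inner ℝ x c + ‖c‖ ^ 2 := norm_sub_sq_real x c
  have e3 : inner ℝ (x - c) x = (‖x - c‖ ^ 2 + ‖x‖ ^ 2 - ‖c‖ ^ 2) / 2 := by
    rw [e1, e2]; ring
  rw [e3]
  generalize ‖x - c‖ ^ 2 = N at *
  have key : ((‖c‖ ^ 2 - 1) / N) * (1 - ‖x‖ ^ 2) * ((‖c‖ ^ 2 - 1) / N * (1 - ‖x‖ ^ 2) *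
      Laplacian.laplacian h (ballInversion c x)) =
      ((‖c‖ ^ 2 - 1) / N) * (1 - ‖x‖ ^ 2) * (-(2 * ((n : ℝ) - 2) *
      ((‖c‖ ^ 2 - 1) / N * L (x - c) + L c))) := by rw [hz]
  have hN' := hN.ne'
  rw [← sub_eq_zero] at key
  rw [← key]
  field_simp
  ring

end Inversion

/-! ### The estimate at every point and its integrated form. -/

section Main

variable {n : ℕ} {h : EuclideanSpace ℝ (Fin n) → ℝ}

theorem IsHyperbolicHarmonic.fderiv_le (hh : IsHyperbolicHarmonic h) (hn3 : 3 ≤ n)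
    (hmaps : ∀ x ∈ unitBall n, h x ∈ Ioo (-1 : ℝ) 1) {a u : EuclideanSpace ℝ (Fin n)}
    (ha : ‖a‖ < 1) (hu : ‖u‖ = 1) :
    fderiv ℝ h a u ≤ (n - 1) * ((1 - h a ^ 2) / (1 - ‖a‖ ^ 2)) := by
  rcases eq_or_ne a 0 with rfl | ha0
  · simpa using hh.fderiv_zero_le hn3 hmaps hu
  have hapos : 0 < ‖a‖ := norm_pos_iff.2 ha0
  -- With this centre the inversion sends `0` to `a`, with conformal factor `1 - |a|²` at `0`.
  set c : EuclideanSpace ℝ (Fin n) := (‖a‖ ^ 2)⁻¹ • a with hcdef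
  have hcn : ‖c‖ = ‖a‖⁻¹ := by
    rw [hcdef, norm_smul, norm_inv, norm_pow, norm_norm]
    field_simp
  have hc : 1 < ‖c‖ := by rw [hcn]; exact (one_lt_inv₀ hapos).2 ha
  have hfac : (‖c‖ ^ 2 - 1) / ‖0 - c‖ ^ 2 = 1 - ‖a‖ ^ 2 := by
    rw [zero_sub, norm_neg, hcn]
    field_simp
  have hT0 : ballInversion c 0 = a := by
    rw [ballInversion_apply hc, hfac, hcdef, zero_sub, smul_neg, smul_smul]
    rw [← neg_smul, ← add_smul]
    have : -((1 - ‖a‖ ^ 2) * (‖a‖ ^ 2)⁻¹) + (‖a‖ ^ 2)⁻¹ = 1 := by field_simp; ring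
    rw [this, one_smul]
  have h0 : ‖(0 : EuclideanSpace ℝ (Fin n))‖ < 1 := by simp
  set refl := (ℝ ∙ (0 - c))ᗮ.reflection with hrefl
  have hbound := (hh.comp_ballInversion hc).fderiv_zero_le hn3
    (fun x hx => hmaps _ (by
      simpa [unitBall] using norm_ballInversion_lt_one hc (by simpa [unitBall] using hx)))
    -- The reflection is an involution, so the derivative of the inversion at `0` sends `refl u` to
    -- `(1 - |a|²) u`.
    (e := refl u) (by rw [LinearIsometryEquiv.norm_map, hu])
  rw [fderiv_comp_ballInversion hh hc h0, Function.comp_apply, hT0, hfac, ← hrefl,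
    Submodule.reflection_reflection, map_smul, smul_eq_mul] at hbound
  have hpos : 0 < 1 - ‖a‖ ^ 2 := by nlinarith
  rw [mul_div_assoc', le_div_iff₀ hpos]
  linarith

theorem IsHyperbolicHarmonic.norm_fderiv_le (hh : IsHyperbolicHarmonic h) (hn3 : 3 ≤ n)
    (hmaps : ∀ x ∈ unitBall n, h x ∈ Ioo (-1 : ℝ) 1) {a : EuclideanSpace ℝ (Fin n)}
    (ha : ‖a‖ < 1) :
    ‖fderiv ℝ h a‖ ≤ (n - 1) * ((1 - h a ^ 2) / (1 - ‖a‖ ^ 2)) := by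
  have hpos : 0 < 1 - ‖a‖ ^ 2 := by nlinarith [norm_nonneg a]
  have hha := hmaps a (by simpa [unitBall] using ha)
  have hpos' : 0 ≤ 1 - h a ^ 2 := by nlinarith [hha.1, hha.2]
  have hn' : (3 : ℝ) ≤ n := by exact_mod_cast hn3
  refine ContinuousLinearMap.opNorm_le_of_unit_norm
    (mul_nonneg (by linarith) (div_nonneg hpos' hpos.le)) fun u hu => ?_
  rw [Real.norm_eq_abs, abs_le']
  refine ⟨hh.fderiv_le hn3 hmaps ha hu, ?_⟩
  simpa using hh.fderiv_le hn3 hmaps ha (u := -u) (by simpa using hu)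

theorem norm_gradient_eq_norm_fderiv (h : EuclideanSpace ℝ (Fin n) → ℝ)
    (x : EuclideanSpace ℝ (Fin n)) : ‖gradient h x‖ = ‖fderiv ℝ h x‖ := by
  rw [gradient, LinearIsometryEquiv.norm_map]

theorem IsBallCurve.segment {x y : EuclideanSpace ℝ (Fin n)} (hx : x ∈ unitBall n)
    (hy : y ∈ unitBall n) : IsBallCurve (fun t : ℝ => AffineMap.lineMap x y t) x y where
  contDiffOn := by
    simp only [AffineMap.lineMap_apply_module]
    fun_prop
  mapsTo := fun t ht => (convex_ball 0 1).lineMap_mem hx hy ht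
  source := by simp
  target := by simp

theorem norm_inclusion_diameter (r : ℝ) : ‖(!₂[r, 0] : EuclideanSpace ℝ (Fin 2))‖ = |r| := by
  simp [EuclideanSpace.norm_eq, Real.sqrt_sq_eq_abs]

/-- The real diameter as a linear embedding of `ℝ` into the plane. -/
noncomputable def diameterInclusion : ℝ →L[ℝ] EuclideanSpace ℝ (Fin 2) :=
  ContinuousLinearMap.toSpanSingleton ℝ !₂[1, 0]

theorem diameterInclusion_apply (r : ℝ) : diameterInclusion r = !₂[r, 0] := by
  ext i
  fin_cases i <;> simp [diameterInclusion]

theorem hyperbolicLength_nonneg {γ : ℝ → EuclideanSpace ℝ (Fin n)}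
    (hγ : MapsTo γ (Icc 0 1) (unitBall n)) : 0 ≤ hyperbolicLength γ := by
  refine intervalIntegral.integral_nonneg zero_le_one fun t ht => ?_
  have h1 : ‖γ t‖ < 1 := by simpa [unitBall] using hγ ht
  have h2 : 0 < 1 - ‖γ t‖ ^ 2 := by nlinarith [norm_nonneg (γ t)]
  positivity

theorem intervalIntegrable_hyperbolicLength {γ : ℝ → EuclideanSpace ℝ (Fin n)}
    {x y : EuclideanSpace ℝ (Fin n)} (hγ : IsBallCurve γ x y) :
    IntervalIntegrable (fun t => 2 * ‖derivWithin γ (Icc 0 1) t‖ / (1 - ‖γ t‖ ^ 2))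
      volume 0 1 := by
  refine ContinuousOn.intervalIntegrable ?_
  rw [uIcc_of_le zero_le_one]
  have hd : ContinuousOn (derivWithin γ (Icc 0 1)) (Icc 0 1) :=
    hγ.contDiffOn.continuousOn_derivWithin (uniqueDiffOn_Icc zero_lt_one) le_rfl
  have hc := hγ.contDiffOn.continuousOn
  refine ContinuousOn.div (by fun_prop) (by fun_prop) fun t ht => ?_
  have h1 : ‖γ t‖ < 1 := by simpa [unitBall] using hγ.mapsTo ht
  nlinarith [norm_nonneg (γ t)]

theorem hyperbolicDist_le_hyperbolicLength {γ : ℝ → EuclideanSpace ℝ (Fin n)}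
    {x y : EuclideanSpace ℝ (Fin n)} (hγ : IsBallCurve γ x y) :
    hyperbolicDist x y ≤ hyperbolicLength γ :=
  csInf_le ⟨0, fun _ ⟨_, hδ, hL⟩ => hL ▸ hyperbolicLength_nonneg hδ.mapsTo⟩ ⟨γ, hγ, rfl⟩

theorem IsHyperbolicHarmonic.isBallCurve_comp (hh : IsHyperbolicHarmonic h)
    (hmaps : ∀ x ∈ unitBall n, h x ∈ Ioo (-1 : ℝ) 1) {γ : ℝ → EuclideanSpace ℝ (Fin n)}
    {x y : EuclideanSpace ℝ (Fin n)} (hγ : IsBallCurve γ x y) :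
    IsBallCurve (fun t => diameterInclusion (h (γ t))) !₂[h x, 0] !₂[h y, 0] where
  contDiffOn := diameterInclusion.contDiff.comp_contDiffOn
    (hh.contDiffOn_one.comp hγ.contDiffOn hγ.mapsTo)
  mapsTo := fun t ht => by
    have := hmaps _ (hγ.mapsTo ht)
    simpa [unitBall, diameterInclusion_apply, norm_inclusion_diameter, abs_lt] using this
  source := by rw [hγ.source, diameterInclusion_apply]
  target := by rw [hγ.target, diameterInclusion_apply]

theorem IsHyperbolicHarmonic.hyperbolicLength_comp_le (hh : IsHyperbolicHarmonic h) (hn3 : 3 ≤ n)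
    (hmaps : ∀ x ∈ unitBall n, h x ∈ Ioo (-1 : ℝ) 1) {γ : ℝ → EuclideanSpace ℝ (Fin n)}
    {x y : EuclideanSpace ℝ (Fin n)} (hγ : IsBallCurve γ x y) :
    hyperbolicLength (fun t => diameterInclusion (h (γ t))) ≤
      ((n : ℝ) - 1) * hyperbolicLength γ := by
  rw [hyperbolicLength, hyperbolicLength, ← intervalIntegral.integral_const_mul]
  refine intervalIntegral.integral_mono_on zero_le_one
    (intervalIntegrable_hyperbolicLength (hh.isBallCurve_comp hmaps hγ))
    ((intervalIntegrable_hyperbolicLength hγ).const_mul _) fun t ht => ?_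
  have hγt : ‖γ t‖ < 1 := by simpa [unitBall] using hγ.mapsTo ht
  have hpos : 0 < 1 - ‖γ t‖ ^ 2 := by nlinarith [norm_nonneg (γ t)]
  have hht := hmaps _ (hγ.mapsTo ht)
  have hpos' : 0 < 1 - h (γ t) ^ 2 := by nlinarith [hht.1, hht.2]
  have hu : UniqueDiffWithinAt ℝ (Icc (0 : ℝ) 1) t := uniqueDiffOn_Icc zero_lt_one t ht
  have dγ : HasDerivWithinAt γ (derivWithin γ (Icc 0 1) t) (Icc 0 1) t :=
    (hγ.contDiffOn.differentiableOn one_ne_zero t ht).hasDerivWithinAt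
  have d := diameterInclusion.hasFDerivAt.comp_hasDerivWithinAt t
    ((hh.differentiableAt hγt).hasFDerivAt.comp_hasDerivWithinAt t dγ)
  have hd : derivWithin (fun t => diameterInclusion (h (γ t))) (Icc 0 1) t =
      diameterInclusion (fderiv ℝ h (γ t) (derivWithin γ (Icc 0 1) t)) := d.derivWithin hu
  rw [hd, diameterInclusion_apply, diameterInclusion_apply, norm_inclusion_diameter,
    norm_inclusion_diameter, sq_abs, div_le_iff₀ hpos']
  have h1 : |fderiv ℝ h (γ t) (derivWithin γ (Icc 0 1) t)| ≤
      (n - 1) * ((1 - h (γ t) ^ 2) / (1 - ‖γ t‖ ^ 2)) * ‖derivWithin γ (Icc 0 1) t‖ :=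
    ((fderiv ℝ h (γ t)).le_opNorm _).trans
      (mul_le_mul_of_nonneg_right (hh.norm_fderiv_le hn3 hmaps hγt) (norm_nonneg _))
  calc 2 * |fderiv ℝ h (γ t) (derivWithin γ (Icc 0 1) t)|
      ≤ 2 * ((n - 1) * ((1 - h (γ t) ^ 2) / (1 - ‖γ t‖ ^ 2))
          * ‖derivWithin γ (Icc 0 1) t‖) := by linarith
    _ = _ := by ring

end Main

/-- A hyperbolic harmonic function `h : 𝔹ⁿ → (-1, 1)`, `n ≥ 3`, satisfies a pointwise gradient
estimate and is `(n - 1)`-Lipschitz from the hyperbolic distance of the ball to the Poincaré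
distance of the unit disc, in which `(-1, 1)` is the real diameter. -/
theorem mainTheorem5 (n : ℕ) (hn : 3 ≤ n) (h : EuclideanSpace ℝ (Fin n) → ℝ)
    (hmaps : ∀ x ∈ unitBall n, h x ∈ Set.Ioo (-1 : ℝ) 1)
    (hharm : IsHyperbolicHarmonic h) :
    (∀ x ∈ unitBall n, ‖gradient h x‖ ≤ ((n : ℝ) - 1) * ((1 - |h x| ^ 2) / (1 - ‖x‖ ^ 2))) ∧
    (∀ x₁ ∈ unitBall n, ∀ x₂ ∈ unitBall n,
      hyperbolicDist (!₂[h x₁, 0] : EuclideanSpace ℝ (Fin 2)) !₂[h x₂, 0]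
        ≤ ((n : ℝ) - 1) * hyperbolicDist x₁ x₂) := by
  refine ⟨fun x hx => ?_, fun x₁ hx₁ x₂ hx₂ => ?_⟩
  · rw [norm_gradient_eq_norm_fderiv, sq_abs]
    exact hharm.norm_fderiv_le hn hmaps (by simpa [unitBall] using hx)
  · have hn' : (3 : ℝ) ≤ n := by exact_mod_cast hn
    have hpos : 0 < (n : ℝ) - 1 := by linarith
    rw [← div_le_iff₀' hpos]
    -- The segment shows that the set of lengths is nonempty, without which the real infimum would
    -- be the default value `0`.
    refine le_csInf ⟨_, _, IsBallCurve.segment hx₁ hx₂, rfl⟩ ?_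
    rintro _ ⟨γ, hγ, rfl⟩
    rw [div_le_iff₀' hpos]
    exact (hyperbolicDist_le_hyperbolicLength (hharm.isBallCurve_comp hmaps hγ)).trans
      (hharm.hyperbolicLength_comp_le hn hmaps hγ)
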